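/- Let $k$ be a field of characteristic $p \geq 3$, and let $P_1 = k[u,v]/\langle u^p+v^2\rangle$, considered as a $k$-superalgebra (i.e. a $\mathbb{Z}/2$-graded algebra) with $u$ even and $v$ odd, and as a Hopf superalgebra with $u$ and $v$ primitive. For $P_1$-supermodules $M$ and $N$ (not necessarily finite-dimensional) let $\operatorname{Ext}^i_{P_1}(M,N) = \operatorname{Ext}^i_{P_1}(M,N)_{\overline 0} \oplus \operatorname{Ext}^i_{P_1}(M,N)_{\overline 1}$ be the derived functors of $\operatorname{Hom}_{P_1}(M,-)$ on the abelian category of $P_1$-supermodules and even homomorphisms, where $\operatorname{Hom}_{P_1}(M,N)$ is the superspace of even and odd homomorphisms; an odd homomorphism $f$ satisfies $f(a.m) = (-1)^{\overline a} a.f(m)$. Put $H^i(P_1,k) = \operatorname{Ext}^i_{P_1}(k,k)$, and let $\operatorname{pd}_{P_1}(M)$ be the projective dimension of $M$ in this abelian category. **Proposition.** Let $M$ and $N$ be $P_1$-supermodules, and let $0 \neq y \in H^1(P_1,k)_{\overline 1}$. Then for all $i \geq 2$ the right cup product action of $y$, $z \mapsto z \cup y$, is an odd isomorphism $$\operatorname{Ext}^i_{P_1}(M,N)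 \simeq \operatorname{Ext}^{i+1}_{P_1}(M,N),$$ i.e. it restricts to $k$-linear isomorphisms $\operatorname{Ext}^i_{P_1}(M,N)_{s} \cong \operatorname{Ext}^{i+1}_{P_1}(M,N)_{s+\overline 1}$ for $s \in \mathbb{Z}/2$. Moreover, $\operatorname{pd}_{P_1}(M) = \infty$ if and only if the cup product $1_M \cup y^2 \in \operatorname{Ext}^2_{P_1}(M,M)$ is nonzero, where $1_M \in \operatorname{Ext}^0_{P_1}(M,M)$ is the identity map of $M$. -/

import Mathlib

namespace SuperP1

open CategoryTheory CategoryTheory.Limits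
open scoped TensorProduct

universe u

section Algebra

variable (k : Type u) [Field k] (p : ℕ)

/-- The algebra `P₁ = k[u,v]/⟨u^p + v²⟩`. -/
def P1 : Type u :=
  MvPolynomial (Fin 2) k ⧸
    Ideal.span {(MvPolynomial.X 0 ^ p + MvPolynomial.X 1 ^ 2 : MvPolynomial (Fin 2) k)}

noncomputable instance : CommRing (P1 k p) :=
  inferInstanceAs (CommRing (MvPolynomial (Fin 2) k ⧸
    Ideal.span {(MvPolynomial.X 0 ^ p + MvPolynomial.X 1 ^ 2 : MvPolynomial (Fin 2) k)}))

noncomputable instance : Algebra k (P1 k p) :=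
  inferInstanceAs (Algebra k (MvPolynomial (Fin 2) k ⧸
    Ideal.span {(MvPolynomial.X 0 ^ p + MvPolynomial.X 1 ^ 2 : MvPolynomial (Fin 2) k)}))

namespace P1

/-- The quotient map `k[u,v] → P₁`. -/
noncomputable def mk : MvPolynomial (Fin 2) k →ₐ[k] P1 k p :=
  Ideal.Quotient.mkₐ k
    (Ideal.span {(MvPolynomial.X 0 ^ p + MvPolynomial.X 1 ^ 2 : MvPolynomial (Fin 2) k)})

/-- The even generator `u` of `P₁`. -/
noncomputable def u : P1 k p := mk k p (MvPolynomial.X 0)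

/-- The odd generator `v` of `P₁`. -/
noncomputable def v : P1 k p := mk k p (MvPolynomial.X 1)

/-- The `ℤ/2`-grading of the superalgebra `P₁`, with `u` even and `v` odd. -/
noncomputable def gr (i : ZMod 2) : Submodule k (P1 k p) :=
  Submodule.span k {x | ∃ a b : ℕ, (b : ZMod 2) = i ∧ x = u k p ^ a * v k p ^ b}

variable {k p}

lemma u_pow_add_v_sq : u k p ^ p + v k p ^ 2 = 0 := by
  rw [u, v, ← map_pow, ← map_pow, ← map_add]
  exact Ideal.Quotient.eq_zero_iff_mem.2 (Ideal.subset_span rfl)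

lemma mk_surjective : Function.Surjective (mk k p) := Ideal.Quotient.mk_surjective

/-- Every property closed under linear combinations and under multiplication by the generators
holds on all of `P₁`. -/
lemma induction {C : P1 k p → Prop} (h1 : C 1) (hadd : ∀ a b, C a → C b → C (a + b))
    (hsmul : ∀ (c : k) a, C a → C (c • a)) (hu : ∀ a, C a → C (a * u k p))
    (hv : ∀ a, C a → C (a * v k p)) (a : P1 k p) : C a := by
  obtain ⟨a, rfl⟩ := mk_surjective a
  induction a using MvPolynomial.induction_on with
  | C c =>
    have h := hsmul c 1 h1
    rwa [← map_one (mk k p), ← map_smul, MvPolynomial.smul_eq_C_mul, mul_one] at h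
  | add a b ha hb => rw [map_add]; exact hadd _ _ ha hb
  | mul_X a i ha =>
    rw [map_mul]
    fin_cases i
    · exact hu _ ha
    · exact hv _ ha

/-- The universal property of `P₁`: an algebra homomorphism to a (possibly noncommutative)
algebra is given by commuting elements `U`, `V` with `U^p + V² = 0`. -/
lemma exists_lift {R : Type*} [Ring R] [Algebra k R] (U V : R) (hc : U * V = V * U)
    (hr : U ^ p + V ^ 2 = 0) :
    ∃ f : P1 k p →ₐ[k] R, f (u k p) = U ∧ f (v k p) = V := by
  have hcomm : ∀ a ∈ ({U, V} : Set R), ∀ b ∈ ({U, V} : Set R), a * b = b * a := by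
    rintro a (rfl | rfl) b (rfl | rfl) <;> simp [hc]
  have hi := Algebra.isMulCommutative_adjoin k hcomm
  let S := Algebra.adjoin k ({U, V} : Set R)
  let _ : CommRing S := { (inferInstance : Ring S) with
    mul_comm := fun a b => hi.is_comm.comm a b }
  let U' : S := ⟨U, Algebra.subset_adjoin (by simp)⟩
  let V' : S := ⟨V, Algebra.subset_adjoin (by simp)⟩
  let g : MvPolynomial (Fin 2) k →ₐ[k] S := MvPolynomial.aeval ![U', V']
  have hg : ∀ a ∈ Ideal.span
      {(MvPolynomial.X 0 ^ p + MvPolynomial.X 1 ^ 2 : MvPolynomial (Fin 2) k)}, g a = 0 := by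
    intro a ha
    have h0 : g (MvPolynomial.X 0 ^ p + MvPolynomial.X 1 ^ 2) = 0 := by
      rw [map_add, map_pow, map_pow, MvPolynomial.aeval_X, MvPolynomial.aeval_X]
      exact Subtype.ext hr
    obtain ⟨b, rfl⟩ := Ideal.mem_span_singleton'.1 ha
    rw [map_mul, h0, mul_zero]
  let h : P1 k p →ₐ[k] S := Ideal.Quotient.liftₐ _ g hg
  refine ⟨S.val.comp h, ?_, ?_⟩
  · change S.val (g (MvPolynomial.X 0)) = U
    simp [g, U']
  · change S.val (g (MvPolynomial.X 1)) = V
    simp [g, V']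

/-- The algebra homomorphism out of `P₁` sending `u` to `U` and `v` to `V`. -/
noncomputable def lift {R : Type*} [Ring R] [Algebra k R] (U V : R) (hc : U * V = V * U)
    (hr : U ^ p + V ^ 2 = 0) : P1 k p →ₐ[k] R :=
  (exists_lift U V hc hr).choose

section
variable {R : Type*} [Ring R] [Algebra k R] (U V : R) (hc : U * V = V * U)
    (hr : U ^ p + V ^ 2 = 0)

@[simp] lemma lift_u : lift U V hc hr (u k p) = U := (exists_lift U V hc hr).choose_spec.1
@[simp] lemma lift_v : lift U V hc hr (v k p) = V := (exists_lift U V hc hr).choose_spec.2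
end

end P1

/-- The sign `(-1)^s` for `s ∈ ℤ/2`. -/
def sgn (s : ZMod 2) : k := if s = 0 then 1 else -1

variable {k}

lemma sgn_sq (s : ZMod 2) : sgn k s ^ 2 = 1 := by
  unfold sgn; split_ifs <;> simp

@[simp] lemma sgn_zero : sgn k 0 = 1 := by simp [sgn]

lemma sgn_add (s t : ZMod 2) : sgn k (s + t) = sgn k s * sgn k t := by
  have h : ∀ s t : ZMod 2, (s = 0 ∧ t = 0 ∧ s + t = 0) ∨ (s = 0 ∧ t ≠ 0 ∧ s + t ≠ 0) ∨
      (s ≠ 0 ∧ t = 0 ∧ s + t ≠ 0) ∨ (s ≠ 0 ∧ t ≠ 0 ∧ s + t = 0) := by decide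
  rcases h s t with ⟨h1, h2, h3⟩ | ⟨h1, h2, h3⟩ | ⟨h1, h2, h3⟩ | ⟨h1, h2, h3⟩ <;>
    simp [sgn, h1, h2, h3]

variable {p}

lemma P1.u_mem : P1.u k p ∈ P1.gr k p 0 := Submodule.subset_span ⟨1, 0, by simp, by simp⟩

lemma P1.v_mem : P1.v k p ∈ P1.gr k p 1 := Submodule.subset_span ⟨0, 1, by simp, by simp⟩

/-- The automorphism `a ↦ (-1)^{s·|a|} a` of `P₁`. -/
noncomputable def P1.twist (s : ZMod 2) : P1 k p →ₐ[k] P1 k p :=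
  P1.lift (P1.u k p) (sgn k s • P1.v k p) (by simp [mul_comm])
    (by rw [smul_pow, sgn_sq, one_smul, P1.u_pow_add_v_sq])

@[simp] lemma P1.twist_u (s : ZMod 2) : P1.twist s (P1.u k p) = P1.u k p := P1.lift_u ..
@[simp] lemma P1.twist_v (s : ZMod 2) : P1.twist s (P1.v k p) = sgn k s • P1.v k p :=
  P1.lift_v ..

lemma P1.twist_apply (s : ZMod 2) {i : ZMod 2} {a : P1 k p} (ha : a ∈ P1.gr k p i) :
    P1.twist s a = sgn k (s * i) • a := by
  induction ha using Submodule.span_induction with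
  | mem x hx =>
    obtain ⟨a, b, rfl, rfl⟩ := hx
    rw [map_mul, map_pow, map_pow, P1.twist_u, P1.twist_v, smul_pow, mul_smul_comm]
    congr 1
    induction b with
    | zero => simp
    | succ b ih => rw [pow_succ, ih, Nat.cast_succ, mul_add, mul_one, sgn_add]
  | zero => simp
  | add x y _ _ hx hy => rw [map_add, hx, hy, smul_add]
  | smul c x _ hx => rw [map_smul, hx, smul_comm]

end Algebra

/-- A `P₁`-supermodule: a `k`-superspace `M = M₀ ⊕ M₁` (possibly of infinite dimension) with an
action of `P₁`, i.e. an algebra homomorphism `P₁ → End_k(M)`, such that the homogeneous element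
`a` of degree `i` maps `M_j` into `M_{i+j}`. -/
structure SuperMod (k : Type u) [Field k] (p : ℕ) : Type (u + 1) where
  /-- the underlying vector space -/
  carrier : Type u
  [addCommGroup : AddCommGroup carrier]
  [module : Module k carrier]
  /-- the action of `P₁` -/
  act : P1 k p →ₐ[k] Module.End k carrier
  /-- the homogeneous components -/
  gr : ZMod 2 → Submodule k carrier
  isCompl : IsCompl (gr 0) (gr 1)
  act_mem : ∀ {i j : ZMod 2} {a : P1 k p} {m : carrier},
    a ∈ P1.gr k p i → m ∈ gr j → act a m ∈ gr (i + j)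

attribute [instance] SuperMod.addCommGroup SuperMod.module

namespace SuperMod

variable {k : Type u} [Field k] {p : ℕ}

/-- It suffices to check compatibility with the grading on the generators. -/
lemma act_mem_of_gens {X : Type u} [AddCommGroup X] [Module k X]
    (f : P1 k p →ₐ[k] Module.End k X) (g : ZMod 2 → Submodule k X)
    (hu : ∀ j m, m ∈ g j → f (P1.u k p) m ∈ g j)
    (hv : ∀ j m, m ∈ g j → f (P1.v k p) m ∈ g (1 + j)) {i j : ZMod 2} {a : P1 k p} {m : X}
    (ha : a ∈ P1.gr k p i) (hm : m ∈ g j) : f a m ∈ g (i + j) := by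
  induction ha using Submodule.span_induction with
  | mem x hx =>
    obtain ⟨a, b, rfl, rfl⟩ := hx
    rw [map_mul, map_pow, map_pow, Module.End.mul_apply]
    have h1 : ((f (P1.v k p)) ^ b) m ∈ g (b + j) := by
      induction b with
      | zero => simpa using hm
      | succ b ih =>
        rw [pow_succ', Module.End.mul_apply, Nat.cast_succ, add_comm (b : ZMod 2), add_assoc]
        exact hv _ _ ih
    generalize ((f (P1.v k p)) ^ b) m = x at h1
    induction a with
    | zero => simpa using h1
    | succ a ih =>
      rw [pow_succ', Module.End.mul_apply]
      exact hu _ _ ih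
  | zero => simp
  | add x y _ _ hx hy => rw [map_add]; exact add_mem hx hy
  | smul c x _ hx => rw [map_smul]; exact Submodule.smul_mem _ _ hx

/-- An even homomorphism of supermodules: a `P₁`-linear map preserving the grading. -/
@[ext] structure Hom (M N : SuperMod k p) : Type u where
  /-- the underlying linear map -/
  lin : M.carrier →ₗ[k] N.carrier
  map_act : ∀ (a : P1 k p) (m : M.carrier), lin (M.act a m) = N.act a (lin m)
  map_gr : ∀ {i : ZMod 2} {m : M.carrier}, m ∈ M.gr i → lin m ∈ N.gr i

/-- `P₁`-linearity can be checked on the generators. -/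
lemma map_act_of_gens {M N : SuperMod k p} (f : M.carrier →ₗ[k] N.carrier)
    (hu : ∀ m, f (M.act (P1.u k p) m) = N.act (P1.u k p) (f m))
    (hv : ∀ m, f (M.act (P1.v k p) m) = N.act (P1.v k p) (f m)) (a : P1 k p) (m : M.carrier) :
    f (M.act a m) = N.act a (f m) := by
  induction a using P1.induction generalizing m with
  | h1 => simp
  | hadd a b ha hb => simp [ha, hb]
  | hsmul c a ha => simp [ha]
  | hu a ha => simp [ha, hu]
  | hv a ha => simp [ha, hv]

/-- The category of `P₁`-supermodules and even homomorphisms. -/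
instance : Category (SuperMod k p) where
  Hom := Hom
  id M := ⟨LinearMap.id, fun _ _ => rfl, fun h => h⟩
  comp f g := ⟨g.lin ∘ₗ f.lin, fun a m => by simp [f.map_act, g.map_act],
    fun h => g.map_gr (f.map_gr h)⟩

@[simp] lemma id_lin (M : SuperMod k p) : Hom.lin (𝟙 M) = LinearMap.id := rfl
@[simp] lemma comp_lin {L M N : SuperMod k p} (f : L ⟶ M) (g : M ⟶ N) :
    Hom.lin (f ≫ g) = g.lin ∘ₗ f.lin := rfl

lemma hom_ext {M N : SuperMod k p} {f g : M ⟶ N} (h : ∀ m, f.lin m = g.lin m) : f = g :=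
  Hom.ext (LinearMap.ext h)

section Linear

variable {M N : SuperMod k p}

instance : Zero (M ⟶ N) := ⟨⟨0, by simp, by simp⟩⟩
instance : Add (M ⟶ N) :=
  ⟨fun f g => ⟨f.lin + g.lin, by simp [f.map_act, g.map_act],
    fun h => add_mem (f.map_gr h) (g.map_gr h)⟩⟩
instance : Neg (M ⟶ N) :=
  ⟨fun f => ⟨-f.lin, by simp [f.map_act], fun h => neg_mem (f.map_gr h)⟩⟩
instance : SMul k (M ⟶ N) :=
  ⟨fun c f => ⟨c • f.lin, by simp [f.map_act], fun h => Submodule.smul_mem _ _ (f.map_gr h)⟩⟩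

@[simp] lemma zero_lin : Hom.lin (0 : M ⟶ N) = 0 := rfl
@[simp] lemma add_lin (f g : M ⟶ N) : Hom.lin (f + g) = f.lin + g.lin := rfl
@[simp] lemma neg_lin (f : M ⟶ N) : Hom.lin (-f) = -f.lin := rfl
@[simp] lemma smul_lin (c : k) (f : M ⟶ N) : Hom.lin (c • f) = c • f.lin := rfl

instance : AddCommGroup (M ⟶ N) where
  add_assoc _ _ _ := hom_ext fun _ => add_assoc _ _ _
  zero_add _ := hom_ext fun _ => zero_add _
  add_zero _ := hom_ext fun _ => add_zero _
  neg_add_cancel _ := hom_ext fun _ => neg_add_cancel _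
  add_comm _ _ := hom_ext fun _ => add_comm _ _
  nsmul := nsmulRec
  zsmul := zsmulRec

instance : Module k (M ⟶ N) where
  one_smul _ := hom_ext fun _ => one_smul _ _
  mul_smul _ _ _ := hom_ext fun _ => mul_smul _ _ _
  smul_zero _ := hom_ext fun _ => smul_zero _
  smul_add _ _ _ := hom_ext fun _ => smul_add _ _ _
  add_smul _ _ _ := hom_ext fun _ => add_smul _ _ _
  zero_smul _ := hom_ext fun _ => zero_smul _ _

end Linear

instance : Preadditive (SuperMod k p) where
  add_comp _ _ _ _ _ _ := hom_ext fun _ => by simp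
  comp_add _ _ _ _ _ _ := hom_ext fun _ => rfl

instance : Linear k (SuperMod k p) where
  smul_comp _ _ _ _ _ _ := hom_ext fun _ => by simp
  comp_smul _ _ _ _ _ _ := hom_ext fun _ => rfl

lemma lin_eq_zero {L M N : SuperMod k p} {f : L ⟶ M} {g : M ⟶ N} (w : f ≫ g = 0)
    (x : L.carrier) : g.lin (f.lin x) = 0 :=
  LinearMap.congr_fun (congrArg Hom.lin w) x

/-! ### Projections to the homogeneous components -/

variable (M : SuperMod k p)

lemma isCompl_add_one (i : ZMod 2) : IsCompl (M.gr i) (M.gr (i + 1)) := by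
  fin_cases i
  · exact M.isCompl
  · exact M.isCompl.symm

/-- The projection of `M` onto its component `M_i`. -/
noncomputable def proj (i : ZMod 2) : Module.End k M.carrier :=
  (M.gr i).projection (M.gr (i + 1)) (M.isCompl_add_one i)

variable {M}

lemma proj_mem (i : ZMod 2) (m : M.carrier) : M.proj i m ∈ M.gr i :=
  Submodule.projection_apply_mem _ _

lemma proj_of_mem {i j : ZMod 2} {m : M.carrier} (hm : m ∈ M.gr j) :
    M.proj i m = if i = j then m else 0 := by
  split_ifs with h
  · subst h
    exact Submodule.projection_apply_of_mem_left _ hm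
  · have : j = i + 1 := by
      have h2 : ∀ i j : ZMod 2, i ≠ j → j = i + 1 := by decide
      exact h2 i j h
    subst this
    exact (Submodule.projection_apply_eq_zero_iff _).2 hm

variable (M) in
lemma proj_add_proj (m : M.carrier) : M.proj 0 m + M.proj 1 m = m := by
  have h : m ∈ M.gr 0 ⊔ M.gr 1 := by rw [M.isCompl.sup_eq_top]; trivial
  obtain ⟨a, ha, b, hb, rfl⟩ := Submodule.mem_sup.1 h
  simp [proj_of_mem ha, proj_of_mem hb]

/-- An induction principle: a property closed under addition and true for homogeneous elements
holds for all elements. -/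
lemma homogeneous_induction {C : M.carrier → Prop} (hadd : ∀ a b, C a → C b → C (a + b))
    (h : ∀ i, ∀ m ∈ M.gr i, C m) (m : M.carrier) : C m := by
  rw [← M.proj_add_proj m]
  exact hadd _ _ (h _ _ (proj_mem _ _)) (h _ _ (proj_mem _ _))

lemma map_proj {M N : SuperMod k p} (f : M ⟶ N) (i : ZMod 2) (m : M.carrier) :
    f.lin (M.proj i m) = N.proj i (f.lin m) := by
  induction m using homogeneous_induction with
  | hadd a b ha hb => simp [ha, hb]
  | h j m hm =>
    rw [proj_of_mem hm, proj_of_mem (f.map_gr hm)]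
    split_ifs <;> simp

lemma mem_gr_of_injective {M N : SuperMod k p} (f : M ⟶ N) (hf : Function.Injective f.lin)
    {i : ZMod 2} {m : M.carrier} (hm : f.lin m ∈ N.gr i) : m ∈ M.gr i := by
  have : M.proj i m = m := hf (by rw [map_proj, proj_of_mem hm, if_pos rfl])
  rw [← this]
  exact proj_mem _ _

lemma exists_mem_gr_of_surjective {M N : SuperMod k p} (f : M ⟶ N)
    (hf : Function.Surjective f.lin) {i : ZMod 2} {n : N.carrier} (hn : n ∈ N.gr i) :
    ∃ m ∈ M.gr i, f.lin m = n := by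
  obtain ⟨m, rfl⟩ := hf n
  exact ⟨M.proj i m, proj_mem _ _, by rw [map_proj, proj_of_mem hn, if_pos rfl]⟩

/-! ### The category of supermodules is abelian -/

/-- The zero supermodule. -/
noncomputable def zeroObj : SuperMod k p where
  carrier := PUnit
  act := P1.lift 0 0 rfl (Subsingleton.elim _ _)
  gr _ := ⊤
  isCompl := by
    rw [isCompl_iff, disjoint_iff, codisjoint_iff]
    exact ⟨Subsingleton.elim _ _, by simp⟩
  act_mem _ _ := trivial

instance : HasZeroObject (SuperMod k p) :=
  ⟨⟨zeroObj, (IsZero.iff_id_eq_zero _).2 (hom_ext fun _ => rfl)⟩⟩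

/-- The direct sum of two supermodules. -/
noncomputable def prod (M N : SuperMod k p) : SuperMod k p where
  carrier := M.carrier × N.carrier
  act := AlgHom.ofLinearMap
    { toFun := fun a => (M.act a).prodMap (N.act a)
      map_add' := fun a b => by ext <;> simp
      map_smul' := fun c a => by ext <;> simp }
    (by ext <;> simp) (fun a b => by ext <;> simp)
  gr i := (M.gr i).prod (N.gr i)
  isCompl := by
    constructor
    · rw [disjoint_iff, Submodule.prod_inf_prod, M.isCompl.inf_eq_bot, N.isCompl.inf_eq_bot,
        Submodule.prod_bot]
    · rw [codisjoint_iff, Submodule.prod_sup_prod, M.isCompl.sup_eq_top, N.isCompl.sup_eq_top,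
        Submodule.prod_top]
  act_mem ha hm := ⟨M.act_mem ha hm.1, N.act_mem ha hm.2⟩

/-- The direct sum as a bicone. -/
noncomputable def bicone (M N : SuperMod k p) : BinaryBicone M N where
  pt := prod M N
  fst := ⟨LinearMap.fst k _ _, fun _ _ => rfl, fun h => h.1⟩
  snd := ⟨LinearMap.snd k _ _, fun _ _ => rfl, fun h => h.2⟩
  inl := ⟨LinearMap.inl k _ _, fun a _ => Prod.ext rfl (map_zero (N.act a)).symm, fun h => ⟨h, zero_mem _⟩⟩
  inr := ⟨LinearMap.inr k _ _, fun a _ => Prod.ext (map_zero (M.act a)).symm rfl, fun h => ⟨zero_mem _, h⟩⟩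
  inl_fst := rfl
  inl_snd := rfl
  inr_fst := rfl
  inr_snd := rfl

instance : HasBinaryBiproducts (SuperMod k p) :=
  ⟨fun {M N} => HasBinaryBiproduct.mk ⟨bicone M N, isBinaryBilimitOfTotal _
    (hom_ext fun _ => Prod.ext (add_zero _) (zero_add _))⟩⟩

instance : HasFiniteProducts (SuperMod k p) :=
  hasFiniteProducts_of_has_binary_and_terminal

section Kernels

variable {K M N Q : SuperMod k p}

/-- The kernel of an even homomorphism. -/
noncomputable def ker (f : M ⟶ N) : SuperMod k p where
  carrier := LinearMap.ker f.lin
  act := AlgHom.ofLinearMap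
    { toFun := fun a => (M.act a).restrict (p := LinearMap.ker f.lin) (q := LinearMap.ker f.lin)
        (fun m hm => by
          rw [LinearMap.mem_ker] at hm ⊢
          rw [f.map_act, hm, map_zero])
      map_add' := fun a b => by ext; simp
      map_smul' := fun c a => by ext; simp }
    (by ext; simp) (fun a b => by ext; simp)
  gr i := (M.gr i).comap (LinearMap.ker f.lin).subtype
  isCompl := by
    constructor
    · rw [Submodule.disjoint_def]
      intro x h0 h1
      exact Subtype.ext ((Submodule.disjoint_def.1 M.isCompl.disjoint) _ h0 h1)
    · rw [codisjoint_iff, eq_top_iff]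
      rintro ⟨x, hx⟩ -
      have hp (i : ZMod 2) : M.proj i x ∈ LinearMap.ker f.lin := by
        rw [LinearMap.mem_ker] at hx ⊢
        rw [map_proj, hx, map_zero]
      exact Submodule.mem_sup.2 ⟨⟨_, hp 0⟩, proj_mem _ _, ⟨_, hp 1⟩, proj_mem _ _,
        Subtype.ext (M.proj_add_proj x)⟩
  act_mem ha hm := M.act_mem ha hm

/-- The inclusion of the kernel. -/
noncomputable def kerι (f : M ⟶ N) : ker f ⟶ M :=
  ⟨(LinearMap.ker f.lin).subtype, fun _ _ => rfl, fun h => h⟩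

/-- The cokernel of an even homomorphism. -/
noncomputable def coker (f : M ⟶ N) : SuperMod k p where
  carrier := N.carrier ⧸ LinearMap.range f.lin
  act := AlgHom.ofLinearMap
    { toFun := fun a => (LinearMap.range f.lin).mapQ (LinearMap.range f.lin) (N.act a) (by
          rintro _ ⟨m, rfl⟩
          exact ⟨M.act a m, f.map_act _ _⟩)
      map_add' := fun a b => by ext; simp
      map_smul' := fun c a => by ext; simp }
    (by ext; simp) (fun a b => by ext; simp)
  gr i := (N.gr i).map (LinearMap.range f.lin).mkQ
  isCompl := by
    constructor
    · rw [Submodule.disjoint_def]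
      rintro _ ⟨a, ha, rfl⟩ ⟨b, hb, hab⟩
      rw [← sub_eq_zero, ← map_sub, Submodule.mkQ_apply, Submodule.Quotient.mk_eq_zero] at hab
      obtain ⟨m, hm⟩ := hab
      rw [Submodule.mkQ_apply, Submodule.Quotient.mk_eq_zero]
      refine ⟨-M.proj 0 m, ?_⟩
      rw [map_neg, map_proj, hm, map_sub, proj_of_mem ha, proj_of_mem hb]
      simp
    · rw [codisjoint_iff, ← Submodule.map_sup, N.isCompl.sup_eq_top, Submodule.map_top,
        Submodule.range_mkQ]
  act_mem := by
    rintro i j a _ ha ⟨m, hm, rfl⟩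
    exact ⟨N.act a m, N.act_mem ha hm, rfl⟩

/-- The projection to the cokernel. -/
noncomputable def cokerπ (f : M ⟶ N) : N ⟶ coker f :=
  ⟨(LinearMap.range f.lin).mkQ, fun _ _ => rfl, fun h => ⟨_, h, rfl⟩⟩

/-- An injective even homomorphism whose image is the kernel of `f` is a kernel of `f`. -/
lemma nonempty_isLimit (f : M ⟶ N) (i : K ⟶ M) (w : i ≫ f = 0)
    (hi : Function.Injective i.lin) (he : ∀ m, f.lin m = 0 → ∃ x, i.lin x = m) :
    Nonempty (IsLimit (KernelFork.ofι i w)) := by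
  have key (A : SuperMod k p) (g : A ⟶ M) (hg : g ≫ f = 0) : ∃ l : A ⟶ K, l ≫ i = g := by
    have hr (a : A.carrier) : g.lin a ∈ LinearMap.range i.lin := he _ (lin_eq_zero hg a)
    let l : A.carrier →ₗ[k] K.carrier :=
      (LinearEquiv.ofInjective i.lin hi).symm.toLinearMap ∘ₗ g.lin.codRestrict _ hr
    have hl (a : A.carrier) : i.lin (l a) = g.lin a :=
      congrArg Subtype.val ((LinearEquiv.ofInjective i.lin hi).apply_symm_apply ⟨_, hr a⟩)
    refine ⟨⟨l, fun a m => hi ?_, fun h => mem_gr_of_injective i hi ?_⟩, hom_ext hl⟩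
    · rw [i.map_act, hl, hl, g.map_act]
    · rw [hl]
      exact g.map_gr h
  choose l hl using key
  refine ⟨KernelFork.IsLimit.ofι _ _ (fun g hg => l _ g hg) (fun g hg => hl _ g hg)
    (fun g hg m hm => hom_ext fun x => hi ?_)⟩
  have := hm.trans (hl _ g hg).symm
  exact LinearMap.congr_fun (congrArg Hom.lin this) x

/-- A surjective even homomorphism whose kernel is the image of `f` is a cokernel of `f`. -/
lemma nonempty_isColimit (f : M ⟶ N) (q : N ⟶ Q) (w : f ≫ q = 0)
    (hq : Function.Surjective q.lin) (he : ∀ n, q.lin n = 0 → ∃ x, f.lin x = n) :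
    Nonempty (IsColimit (CokernelCofork.ofπ q w)) := by
  have key (A : SuperMod k p) (g : N ⟶ A) (hg : f ≫ g = 0) : ∃ l : Q ⟶ A, q ≫ l = g := by
    have hr : LinearMap.ker q.lin ≤ LinearMap.ker g.lin := by
      intro n hn
      obtain ⟨x, rfl⟩ := he n hn
      exact lin_eq_zero hg x
    let l : Q.carrier →ₗ[k] A.carrier :=
      (LinearMap.ker q.lin).liftQ g.lin hr ∘ₗ
        (q.lin.quotKerEquivOfSurjective hq).symm.toLinearMap
    have hl (n : N.carrier) : l (q.lin n) = g.lin n := by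
      have : (q.lin.quotKerEquivOfSurjective hq).symm (q.lin n) =
          (LinearMap.ker q.lin).mkQ n := by
        rw [LinearEquiv.symm_apply_eq]
        rfl
      simp [l, this]
    refine ⟨⟨l, fun a m => ?_, fun h => ?_⟩, hom_ext hl⟩
    · obtain ⟨n, rfl⟩ := hq m
      rw [← q.map_act, hl, hl, g.map_act]
    · obtain ⟨n, hn, rfl⟩ := exists_mem_gr_of_surjective q hq h
      rw [hl]
      exact g.map_gr hn
  choose l hl using key
  refine ⟨CokernelCofork.IsColimit.ofπ _ _ (fun g hg => l _ g hg) (fun g hg => hl _ g hg)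
    (fun g hg m hm => hom_ext fun x => ?_)⟩
  obtain ⟨n, rfl⟩ := hq x
  have := hm.trans (hl _ g hg).symm
  exact LinearMap.congr_fun (congrArg Hom.lin this) n

lemma kerι_comp (f : M ⟶ N) : kerι f ≫ f = 0 := hom_ext fun m => m.2

lemma comp_cokerπ (f : M ⟶ N) : f ≫ cokerπ f = 0 :=
  hom_ext fun m => (Submodule.Quotient.mk_eq_zero _).2 ⟨m, rfl⟩

/-- The kernel is a kernel. -/
noncomputable def kerIsLimit (f : M ⟶ N) : IsLimit (KernelFork.ofι (kerι f) (kerι_comp f)) :=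
  (nonempty_isLimit f (kerι f) (kerι_comp f) Subtype.val_injective
    fun m hm => ⟨⟨m, hm⟩, rfl⟩).some

/-- The cokernel is a cokernel. -/
noncomputable def cokerIsColimit (f : M ⟶ N) :
    IsColimit (CokernelCofork.ofπ (cokerπ f) (comp_cokerπ f)) :=
  (nonempty_isColimit f (cokerπ f) (comp_cokerπ f) (Submodule.mkQ_surjective _)
    fun _ hn => (Submodule.Quotient.mk_eq_zero _).1 hn).some

instance : HasKernels (SuperMod k p) := ⟨fun f => ⟨⟨_, kerIsLimit f⟩⟩⟩
instance : HasCokernels (SuperMod k p) := ⟨fun f => ⟨⟨_, cokerIsColimit f⟩⟩⟩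

lemma injective_of_mono (f : M ⟶ N) [Mono f] : Function.Injective f.lin := by
  rw [injective_iff_map_eq_zero]
  intro m hm
  have h : kerι f = 0 := by rw [← cancel_mono f, kerι_comp, zero_comp]
  exact LinearMap.congr_fun (congrArg Hom.lin h) ⟨m, hm⟩

lemma surjective_of_epi (f : M ⟶ N) [Epi f] : Function.Surjective f.lin := by
  intro n
  have h : cokerπ f = 0 := by rw [← cancel_epi f, comp_cokerπ, comp_zero]
  exact (Submodule.Quotient.mk_eq_zero _).1 (LinearMap.congr_fun (congrArg Hom.lin h) n)

instance : IsNormalMonoCategory (SuperMod k p) where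
  normalMonoOfMono f _ := ⟨⟨_, cokerπ f, comp_cokerπ f,
    (nonempty_isLimit (cokerπ f) f (comp_cokerπ f) (injective_of_mono f)
      fun _ hn => (Submodule.Quotient.mk_eq_zero _).1 hn).some⟩⟩

instance : IsNormalEpiCategory (SuperMod k p) where
  normalEpiOfEpi f _ := ⟨⟨_, kerι f, kerι_comp f,
    (nonempty_isColimit (kerι f) f (kerι_comp f) (surjective_of_epi f)
      fun m hm => ⟨⟨m, hm⟩, rfl⟩).some⟩⟩

/-- The category of `P₁`-supermodules and even homomorphisms is abelian. -/
noncomputable instance : Abelian (SuperMod k p) where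

end Kernels

/-! ### Parity shift, trivial module, tensor products -/

section Shift

/-- The map `m ↦ (-1)^{t·|m|} m` of a supermodule `M`. -/
noncomputable def parity (M : SuperMod k p) (t : ZMod 2) : Module.End k M.carrier :=
  M.proj 0 + sgn k t • M.proj 1

lemma parity_apply {M : SuperMod k p} (t : ZMod 2) {i : ZMod 2} {m : M.carrier}
    (hm : m ∈ M.gr i) : M.parity t m = sgn k (t * i) • m := by
  have h : ∀ i : ZMod 2, i = 0 ∨ i = 1 := by decide
  rcases h i with rfl | rfl <;> simp [parity, proj_of_mem hm]

lemma parity_parity {M : SuperMod k p} (t : ZMod 2) (m : M.carrier) :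
    M.parity t (M.parity t m) = m := by
  induction m using homogeneous_induction with
  | hadd a b ha hb => rw [map_add, map_add, ha, hb]
  | h j m hm => rw [parity_apply t hm, map_smul, parity_apply t hm, smul_smul, ← sq, sgn_sq,
      one_smul]

lemma parity_u {M : SuperMod k p} (t : ZMod 2) (m : M.carrier) :
    M.parity t (M.act (P1.u k p) m) = M.act (P1.u k p) (M.parity t m) := by
  induction m using homogeneous_induction with
  | hadd a b ha hb => simp only [map_add, ha, hb]
  | h j m hm => rw [parity_apply t hm, parity_apply t (M.act_mem P1.u_mem hm), zero_add, map_smul]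

lemma parity_v {M : SuperMod k p} (t : ZMod 2) (m : M.carrier) :
    M.parity t (M.act (P1.v k p) m) = sgn k t • M.act (P1.v k p) (M.parity t m) := by
  induction m using homogeneous_induction with
  | hadd a b ha hb => simp only [map_add, ha, hb, smul_add]
  | h j m hm => rw [parity_apply t hm, parity_apply t (M.act_mem P1.v_mem hm), map_smul,
      smul_smul, ← sgn_add, mul_add, mul_one]

/-- The parity shift: `shift 0 M = M`, and `shift 1 M` is `M` with its two homogeneous components
interchanged and with `a ∈ P₁` acting as `m ↦ (-1)^{|a|} a • m`. An even homomorphism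
`shift s M ⟶ N` is the same thing as a homomorphism `f : M → N` of degree `s`, i.e. a linear map
with `f (M_i) ⊆ N_{i+s}` and `f (a • m) = (-1)^{|a|·s} a • f m`. -/
noncomputable def shift (s : ZMod 2) (M : SuperMod k p) : SuperMod k p where
  carrier := M.carrier
  act := M.act.comp (P1.twist s)
  gr i := M.gr (i + s)
  isCompl := by
    rw [zero_add, add_comm 1 s]
    exact M.isCompl_add_one s
  act_mem {i j a m} ha hm := by
    rw [AlgHom.comp_apply, P1.twist_apply s ha, map_smul, LinearMap.smul_apply, add_assoc]
    exact Submodule.smul_mem _ _ (M.act_mem ha hm)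

/-- The identification `shift 0 M = M`. -/
noncomputable def shiftZero (M : SuperMod k p) : shift 0 M ⟶ M :=
  ⟨LinearMap.id,
    map_act_of_gens (M := shift 0 M) (N := M) LinearMap.id
      (fun m => by
        change M.act (P1.twist 0 (P1.u k p)) m = M.act (P1.u k p) m
        rw [P1.twist_u])
      (fun m => by
        change M.act (P1.twist 0 (P1.v k p)) m = M.act (P1.v k p) m
        rw [P1.twist_v, sgn_zero, one_smul]),
    fun {i m} h => by
      have h' : m ∈ M.gr (i + 0) := h
      rwa [add_zero] at h'⟩

end Shift

/-- The trivial supermodule `k`, concentrated in even degree, with `u` and `v` acting by zero. -/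
noncomputable def triv (k : Type u) [Field k] (p : ℕ) [hp : Fact p.Prime] : SuperMod k p where
  carrier := k
  act := P1.lift 0 0 rfl (by simp [hp.out.ne_zero])
  gr i := if i = 0 then ⊤ else ⊥
  isCompl := by simpa using isCompl_top_bot
  act_mem := by
    intro i j a m ha hm
    exact act_mem_of_gens _ (fun i => if i = 0 then ⊤ else ⊥) (fun _ _ _ => by simp)
      (fun _ _ _ => by simp) ha hm

section Tensor

variable (M N : SuperMod k p)

/-- The action of `u` on `M ⊗ N`, given by `Δ(u) = u ⊗ 1 + 1 ⊗ u`. -/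
noncomputable def tensorU : Module.End k (M.carrier ⊗[k] N.carrier) :=
  TensorProduct.map (M.act (P1.u k p)) LinearMap.id +
    TensorProduct.map LinearMap.id (N.act (P1.u k p))

/-- The action of `v` on `M ⊗ N`, given by `Δ(v) = v ⊗ 1 + 1 ⊗ v`, i.e.
`v • (m ⊗ n) = (v • m) ⊗ n + (-1)^{|m|} m ⊗ (v • n)`. -/
noncomputable def tensorV : Module.End k (M.carrier ⊗[k] N.carrier) :=
  TensorProduct.map (M.act (P1.v k p)) LinearMap.id +
    TensorProduct.map (M.parity 1) (N.act (P1.v k p))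

/-- The grading `(M ⊗ N)_r = ⨁_{i+j=r} M_i ⊗ N_j`. -/
def tensorGr (r : ZMod 2) : Submodule k (M.carrier ⊗[k] N.carrier) :=
  Submodule.span k {x | ∃ i j : ZMod 2, i + j = r ∧ ∃ m ∈ M.gr i, ∃ n ∈ N.gr j, x = m ⊗ₜ[k] n}

variable {M N}

lemma tensorU_tmul (m : M.carrier) (n : N.carrier) :
    tensorU M N (m ⊗ₜ n) = M.act (P1.u k p) m ⊗ₜ n + m ⊗ₜ N.act (P1.u k p) n := rfl

lemma tensorV_tmul (m : M.carrier) (n : N.carrier) :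
    tensorV M N (m ⊗ₜ n) = M.act (P1.v k p) m ⊗ₜ n + M.parity 1 m ⊗ₜ N.act (P1.v k p) n := rfl

lemma tmul_mem {i j : ZMod 2} {m : M.carrier} {n : N.carrier} (hm : m ∈ M.gr i)
    (hn : n ∈ N.gr j) : m ⊗ₜ[k] n ∈ tensorGr M N (i + j) :=
  Submodule.subset_span ⟨i, j, rfl, m, hm, n, hn, rfl⟩

lemma act_u_act_v (m : M.carrier) :
    M.act (P1.u k p) (M.act (P1.v k p) m) = M.act (P1.v k p) (M.act (P1.u k p) m) := by
  rw [← Module.End.mul_apply, ← Module.End.mul_apply, ← map_mul, ← map_mul, mul_comm]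

lemma tensor_comm : tensorU M N * tensorV M N = tensorV M N * tensorU M N := by
  apply TensorProduct.ext'
  intro m n
  simp only [Module.End.mul_apply, tensorU_tmul, tensorV_tmul, map_add, parity_u, act_u_act_v]
  abel

lemma tensorV_sq : tensorV M N ^ 2 =
    TensorProduct.map (M.act (P1.v k p ^ 2)) LinearMap.id +
      TensorProduct.map LinearMap.id (N.act (P1.v k p ^ 2)) := by
  apply TensorProduct.ext'
  intro m n
  have h1 : sgn k 1 = -1 := by simp [sgn]
  simp only [sq, Module.End.mul_apply, tensorV_tmul, map_add, parity_v, parity_parity, h1,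
    LinearMap.add_apply, TensorProduct.map_tmul, map_mul, LinearMap.id_apply, neg_smul, one_smul,
    TensorProduct.neg_tmul]
  abel

lemma tensorU_pow [hp : Fact p.Prime] [CharP k p] : tensorU M N ^ p =
    TensorProduct.map (M.act (P1.u k p ^ p)) LinearMap.id +
      TensorProduct.map LinearMap.id (N.act (P1.u k p ^ p)) := by
  have hc : Commute (TensorProduct.map (M.act (P1.u k p)) (LinearMap.id (R := k) (M := N.carrier)))
      (TensorProduct.map (LinearMap.id (R := k) (M := M.carrier)) (N.act (P1.u k p))) :=
    TensorProduct.ext' fun _ _ => rfl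
  obtain ⟨r, hr⟩ := hc.exists_add_pow_prime_eq hp.out
  have h0 : ((p : ℕ) : Module.End k (M.carrier ⊗[k] N.carrier)) = 0 := by
    rw [← map_natCast (algebraMap k (Module.End k (M.carrier ⊗[k] N.carrier))), CharP.cast_eq_zero,
      map_zero]
  have h1 (X : Type u) [AddCommGroup X] [Module k X] :
      (LinearMap.id (R := k) (M := X)) ^ p = LinearMap.id := one_pow p
  rw [tensorU, hr, h0, TensorProduct.map_pow, TensorProduct.map_pow, h1, h1, map_pow, map_pow]
  simp

lemma tensor_rel [Fact p.Prime] [CharP k p] : tensorU M N ^ p + tensorV M N ^ 2 = 0 := by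
  rw [tensorU_pow, tensorV_sq, add_add_add_comm, ← TensorProduct.map_add_left,
    ← TensorProduct.map_add_right, ← map_add, ← map_add, P1.u_pow_add_v_sq, map_zero, map_zero,
    TensorProduct.map_zero_left, TensorProduct.map_zero_right, add_zero]

/-- The projection of `M ⊗ N` to its component of degree `r`. -/
noncomputable def tensorProj (M N : SuperMod k p) (r : ZMod 2) :
    Module.End k (M.carrier ⊗[k] N.carrier) :=
  TensorProduct.map (M.proj 0) (N.proj r) + TensorProduct.map (M.proj 1) (N.proj (r + 1))

lemma tensorProj_of_mem {r s : ZMod 2} {x : M.carrier ⊗[k] N.carrier}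
    (hx : x ∈ tensorGr M N s) : tensorProj M N r x = if r = s then x else 0 := by
  induction hx using Submodule.span_induction with
  | mem x hx =>
    obtain ⟨i, j, rfl, m, hm, n, hn, rfl⟩ := hx
    simp only [tensorProj, LinearMap.add_apply, TensorProduct.map_tmul, proj_of_mem hm,
      proj_of_mem hn]
    have h : ∀ i j r : ZMod 2,
        (r = i + j ∧ ((0 = i ∧ r = j ∧ 1 ≠ i) ∨ (0 ≠ i ∧ 1 = i ∧ r + 1 = j))) ∨
        (r ≠ i + j ∧ ((0 ≠ i ∧ r + 1 ≠ j) ∨ (r ≠ j ∧ 1 ≠ i))) := by decide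
    rcases h i j r with ⟨h1, ⟨h2, h3, h4⟩ | ⟨h2, h3, h4⟩⟩ | ⟨h1, ⟨h2, h3⟩ | ⟨h2, h3⟩⟩
    · rw [if_pos h1, if_pos h2, if_pos h3, if_neg h4, TensorProduct.zero_tmul, add_zero]
    · rw [if_pos h1, if_neg h2, if_pos h3, if_pos h4, TensorProduct.zero_tmul, zero_add]
    · rw [if_neg h1, if_neg h2, if_neg h3, TensorProduct.zero_tmul, TensorProduct.tmul_zero,
        add_zero]
    · rw [if_neg h1, if_neg h2, if_neg h3, TensorProduct.zero_tmul, TensorProduct.tmul_zero,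
        add_zero]
  | zero => simp
  | add x y _ _ hx hy => rw [map_add, hx, hy]; split_ifs <;> simp
  | smul c x _ hx => rw [map_smul, hx]; split_ifs <;> simp

lemma tensorGr_isCompl : IsCompl (tensorGr M N 0) (tensorGr M N 1) := by
  constructor
  · rw [Submodule.disjoint_def]
    intro x h0 h1
    have h2 := tensorProj_of_mem (r := 0) h0
    rw [tensorProj_of_mem h1] at h2
    simpa using h2.symm
  · rw [codisjoint_iff, eq_top_iff]
    rintro x -
    induction x using TensorProduct.induction_on with
    | zero => exact zero_mem _
    | add x y hx hy => exact add_mem hx hy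
    | tmul m n =>
      induction m using homogeneous_induction with
      | hadd a b ha hb => rw [TensorProduct.add_tmul]; exact add_mem ha hb
      | h i m hm =>
        induction n using homogeneous_induction with
        | hadd a b ha hb => rw [TensorProduct.tmul_add]; exact add_mem ha hb
        | h j n hn =>
          have h : ∀ i j : ZMod 2, i + j = 0 ∨ i + j = 1 := by decide
          have hx := tmul_mem hm hn
          rcases h i j with h | h
          · rw [h] at hx; exact Submodule.mem_sup_left hx
          · rw [h] at hx; exact Submodule.mem_sup_right hx

lemma lTensor_mem {M N N' : SuperMod k p} (f : N ⟶ N') {r : ZMod 2} {x : M.carrier ⊗[k] N.carrier}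
    (hx : x ∈ tensorGr M N r) : f.lin.lTensor M.carrier x ∈ tensorGr M N' r := by
  induction hx using Submodule.span_induction with
  | mem x hx =>
    obtain ⟨i, j, rfl, m, hm, n, hn, rfl⟩ := hx
    exact tmul_mem hm (f.map_gr hn)
  | zero => simp
  | add x y _ _ hx hy => rw [map_add]; exact add_mem hx hy
  | smul c x _ hx => rw [map_smul]; exact Submodule.smul_mem _ _ hx

lemma lTensor_tensorU (M : SuperMod k p) {N N' : SuperMod k p} (f : N ⟶ N') :
    f.lin.lTensor M.carrier ∘ₗ tensorU M N = tensorU M N' ∘ₗ f.lin.lTensor M.carrier :=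
  TensorProduct.ext' fun m n => by simp [tensorU_tmul, f.map_act]

lemma lTensor_tensorV (M : SuperMod k p) {N N' : SuperMod k p} (f : N ⟶ N') :
    f.lin.lTensor M.carrier ∘ₗ tensorV M N = tensorV M N' ∘ₗ f.lin.lTensor M.carrier :=
  TensorProduct.ext' fun m n => by simp [tensorV_tmul, f.map_act]

/-- The map `m ↦ (-1)^{t·|m|} m`, considered as a linear map from `shift r M` to `shift s M`. The
degree `|m|` is that in `M`. -/
noncomputable def shiftParity (M : SuperMod k p) (t r s : ZMod 2) :
    (shift r M).carrier →ₗ[k] (shift s M).carrier :=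
  M.parity t

lemma shiftParity_u (M : SuperMod k p) (t r s : ZMod 2) (m : (shift r M).carrier) :
    shiftParity M t r s ((shift r M).act (P1.u k p) m) =
      (shift s M).act (P1.u k p) (shiftParity M t r s m) := by
  have h (m : M.carrier) : M.parity t (M.act (P1.twist r (P1.u k p)) m) =
      M.act (P1.twist s (P1.u k p)) (M.parity t m) := by
    rw [P1.twist_u, P1.twist_u, parity_u]
  exact h m

lemma shiftParity_v (M : SuperMod k p) {t r s : ZMod 2} (hr : s + t = r)
    (m : (shift r M).carrier) :
    shiftParity M t r s ((shift r M).act (P1.v k p) m) =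
      (shift s M).act (P1.v k p) (shiftParity M t r s m) := by
  have h (m : M.carrier) : M.parity t (M.act (P1.twist r (P1.v k p)) m) =
      M.act (P1.twist s (P1.v k p)) (M.parity t m) := by
    rw [P1.twist_v, P1.twist_v, map_smul, map_smul, LinearMap.smul_apply, LinearMap.smul_apply,
      map_smul, parity_v, ← hr, sgn_add, smul_smul, mul_assoc, ← sq, sgn_sq, mul_one]
  exact h m

lemma shiftParity_mem (M : SuperMod k p) {t r s : ZMod 2} (hr : s + t = r) {i : ZMod 2}
    {m : (shift r M).carrier} (hm : m ∈ (shift r M).gr i) :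
    shiftParity M t r s m ∈ (shift s M).gr (i + t) := by
  have h (m : M.carrier) (hm : m ∈ M.gr (i + r)) : M.parity t m ∈ M.gr (i + t + s) := by
    rw [parity_apply t hm, add_assoc, add_comm t s, hr]
    exact Submodule.smul_mem _ _ hm
  exact h m hm

variable [Fact p.Prime]

/-- The linear map `M ⊗ k → M`, `m ⊗ c ↦ c m`. -/
noncomputable def unitorLin (M : SuperMod k p) :
    M.carrier ⊗[k] (triv k p).carrier →ₗ[k] M.carrier :=
  (TensorProduct.rid k M.carrier).toLinearMap

lemma unitorLin_tmul (M : SuperMod k p) (m : M.carrier) (c : k) :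
    unitorLin M (m ⊗ₜ[k] (show (triv k p).carrier from c)) = c • m := rfl

lemma triv_act_u : (triv k p).act (P1.u k p) = 0 := by
  have hp : p.Prime := Fact.out
  exact P1.lift_u (0 : Module.End k k) 0 rfl (by simp [hp.ne_zero])

lemma triv_act_v : (triv k p).act (P1.v k p) = 0 := by
  have hp : p.Prime := Fact.out
  exact P1.lift_v (0 : Module.End k k) 0 rfl (by simp [hp.ne_zero])

lemma unitorLin_mem {M : SuperMod k p} {r : ZMod 2} {x : M.carrier ⊗[k] (triv k p).carrier}
    (hx : x ∈ tensorGr M (triv k p) r) : unitorLin M x ∈ M.gr r := by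
  induction hx using Submodule.span_induction with
  | mem x hx =>
    obtain ⟨i, j, rfl, m, hm, n, hn, rfl⟩ := hx
    have h0 : ∀ c : k, c ∈ (if j = 0 then (⊤ : Submodule k k) else ⊥) → c • m ∈ M.gr (i + j) := by
      intro c hc
      split_ifs at hc with h
      · rw [h, add_zero]
        exact Submodule.smul_mem _ _ hm
      · rw [(Submodule.mem_bot k).1 hc, zero_smul]
        exact zero_mem _
    exact h0 n hn
  | zero => simp
  | add x y _ _ hx hy => rw [map_add]; exact add_mem hx hy
  | smul c x _ hx => rw [map_smul]; exact Submodule.smul_mem _ _ hx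

/-- The element `1` of `shift t k`. -/
def shiftOne (k : Type u) [Field k] (p : ℕ) [Fact p.Prime] (t : ZMod 2) :
    (shift t (triv k p)).carrier :=
  (1 : k)

lemma shiftOne_mem (t : ZMod 2) : shiftOne k p t ∈ (shift t (triv k p)).gr t := by
  have h : (1 : k) ∈ (if t + t = 0 then (⊤ : Submodule k k) else ⊥) := by
    rw [if_pos (CharTwo.add_self_eq_zero t)]
    trivial
  exact h

lemma shift_triv_act_u (t : ZMod 2) : (shift t (triv k p)).act (P1.u k p) = 0 := by
  have h : (triv k p).act (P1.twist t (P1.u k p)) = 0 := by rw [P1.twist_u, triv_act_u]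
  exact h

lemma shift_triv_act_v (t : ZMod 2) : (shift t (triv k p)).act (P1.v k p) = 0 := by
  have h : (triv k p).act (P1.twist t (P1.v k p)) = 0 := by
    rw [P1.twist_v, map_smul, triv_act_v, smul_zero]
  exact h

variable [CharP k p]

/-- The tensor product of two supermodules, with `P₁` acting through its coproduct, which is the
homomorphism of superalgebras with `Δ(u) = u ⊗ 1 + 1 ⊗ u` and `Δ(v) = v ⊗ 1 + 1 ⊗ v`. -/
noncomputable def tensor (M N : SuperMod k p) : SuperMod k p where
  carrier := M.carrier ⊗[k] N.carrier
  act := P1.lift (tensorU M N) (tensorV M N) tensor_comm tensor_rel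
  gr := tensorGr M N
  isCompl := tensorGr_isCompl
  act_mem := act_mem_of_gens _ _
    (fun j x hx => by
      rw [P1.lift_u]
      induction hx using Submodule.span_induction with
      | mem x hx =>
        obtain ⟨i, j, rfl, m, hm, n, hn, rfl⟩ := hx
        rw [tensorU_tmul]
        refine add_mem ?_ ?_
        · simpa using tmul_mem (M.act_mem P1.u_mem hm) hn
        · simpa using tmul_mem hm (N.act_mem P1.u_mem hn)
      | zero => simp
      | add x y _ _ hx hy => rw [map_add]; exact add_mem hx hy
      | smul c x _ hx => rw [map_smul]; exact Submodule.smul_mem _ _ hx)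
    (fun j x hx => by
      rw [P1.lift_v]
      induction hx using Submodule.span_induction with
      | mem x hx =>
        obtain ⟨i, j, rfl, m, hm, n, hn, rfl⟩ := hx
        rw [tensorV_tmul, parity_apply 1 hm, ← TensorProduct.smul_tmul']
        refine add_mem ?_ (Submodule.smul_mem _ _ ?_)
        · simpa [add_assoc] using tmul_mem (M.act_mem P1.v_mem hm) hn
        · simpa [add_left_comm] using tmul_mem hm (N.act_mem P1.v_mem hn)
      | zero => simp
      | add x y _ _ hx hy => rw [map_add]; exact add_mem hx hy
      | smul c x _ hx => rw [map_smul]; exact Submodule.smul_mem _ _ hx)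

lemma tensor_act_u (M N : SuperMod k p) : (tensor M N).act (P1.u k p) = tensorU M N :=
  P1.lift_u _ _ tensor_comm tensor_rel

lemma tensor_act_v (M N : SuperMod k p) : (tensor M N).act (P1.v k p) = tensorV M N :=
  P1.lift_v _ _ tensor_comm tensor_rel

/-- The map `M ⊗ N ⟶ M ⊗ N'` induced by an even homomorphism `N ⟶ N'`. -/
noncomputable def tensorMap (M : SuperMod k p) {N N' : SuperMod k p} (f : N ⟶ N') :
    tensor M N ⟶ tensor M N' where
  lin := f.lin.lTensor M.carrier
  map_act := map_act_of_gens (M := tensor M N) (N := tensor M N') (f.lin.lTensor M.carrier)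
    (fun x => by
      rw [tensor_act_u, tensor_act_u]
      exact LinearMap.congr_fun (lTensor_tensorU M f) x)
    (fun x => by
      rw [tensor_act_v, tensor_act_v]
      exact LinearMap.congr_fun (lTensor_tensorV M f) x)
  map_gr := lTensor_mem f

/-- The functor `M ⊗ -` on supermodules. -/
noncomputable def tensorLeft (M : SuperMod k p) : SuperMod k p ⥤ SuperMod k p where
  obj N := tensor M N
  map f := tensorMap M f
  map_id _ := Hom.ext (LinearMap.lTensor_id _ _)
  map_comp _ _ := Hom.ext (LinearMap.lTensor_comp _ _ _)

instance (M : SuperMod k p) : (tensorLeft M).Additive where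
  map_add := Hom.ext (LinearMap.lTensor_add _ _ _)

instance (M : SuperMod k p) : (tensorLeft M).Linear k where
  map_smul _ _ := Hom.ext (LinearMap.lTensor_smul _ _ _)

lemma tensorLeft_preservesKernel (L : SuperMod k p) {M N : SuperMod k p} (f : M ⟶ N) :
    PreservesLimit (parallelPair f 0) (tensorLeft L) := by
  refine preservesLimit_of_preserves_limit_cone (kerIsLimit f) ?_
  refine (isLimitMapConeForkEquiv' (tensorLeft L) (kerι_comp f)).symm (Nonempty.some ?_)
  refine nonempty_isLimit _ _ _ ?_ ?_
  · exact Module.Flat.lTensor_preserves_injective_linearMap (M := L.carrier) (kerι f).lin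
      Subtype.val_injective
  · have h : Function.Exact (kerι f).lin f.lin := LinearMap.exact_subtype_ker_map f.lin
    exact fun m hm => (Module.Flat.lTensor_exact L.carrier h m).1 hm

lemma tensorLeft_preservesCokernel (L : SuperMod k p) {M N : SuperMod k p} (f : M ⟶ N) :
    PreservesColimit (parallelPair f 0) (tensorLeft L) := by
  refine preservesColimit_of_preserves_colimit_cocone (cokerIsColimit f) ?_
  refine (isColimitMapCoconeCoforkEquiv' (tensorLeft L) (comp_cokerπ f)).symm (Nonempty.some ?_)
  refine nonempty_isColimit _ _ _ ?_ ?_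
  · exact LinearMap.lTensor_surjective L.carrier (Submodule.mkQ_surjective _)
  · have h : Function.Exact f.lin (cokerπ f).lin := LinearMap.exact_map_mkQ_range f.lin
    exact fun m hm => (Module.Flat.lTensor_exact L.carrier h m).1 hm

/-- Tensoring over the field `k` is exact. -/
instance (L : SuperMod k p) : PreservesFiniteLimits (tensorLeft L) :=
  have := fun {M N : SuperMod k p} (f : M ⟶ N) => tensorLeft_preservesKernel L f
  (tensorLeft L).preservesFiniteLimits_of_preservesKernels

instance (L : SuperMod k p) : PreservesFiniteColimits (tensorLeft L) :=
  have := fun {M N : SuperMod k p} (f : M ⟶ N) => tensorLeft_preservesCokernel L f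
  (tensorLeft L).preservesFiniteColimits_of_preservesCokernels

/-- The canonical isomorphism `M ⊗ k ⟶ M`, `m ⊗ c ↦ c m`. -/
noncomputable def unitor (M : SuperMod k p) : (tensorLeft M).obj (triv k p) ⟶ M where
  lin := unitorLin M
  map_act := map_act_of_gens (M := tensor M (triv k p)) (N := M) (unitorLin M)
    (fun x => by
      have h : unitorLin M ∘ₗ tensorU M (triv k p) = M.act (P1.u k p) ∘ₗ unitorLin M :=
        TensorProduct.ext' fun m c => by
          simp only [LinearMap.comp_apply, tensorU_tmul, triv_act_u, LinearMap.zero_apply,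
            TensorProduct.tmul_zero, add_zero]
          exact (map_smul (M.act (P1.u k p)) (show k from c) m).symm
      rw [tensor_act_u]
      exact LinearMap.congr_fun h x)
    (fun x => by
      have h : unitorLin M ∘ₗ tensorV M (triv k p) = M.act (P1.v k p) ∘ₗ unitorLin M :=
        TensorProduct.ext' fun m c => by
          simp only [LinearMap.comp_apply, tensorV_tmul, triv_act_v, LinearMap.zero_apply,
            TensorProduct.tmul_zero, add_zero]
          exact (map_smul (M.act (P1.v k p)) (show k from c) m).symm
      rw [tensor_act_v]
      exact LinearMap.congr_fun h x)
  map_gr := unitorLin_mem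

/-- The canonical isomorphism `shift (s + t) M ⟶ shift s M ⊗ shift t k`, given by
`m ↦ (-1)^{t·|m|} m ⊗ 1`. Together with `unitor`, it carries the tensor product of two
homomorphisms `f : M → N` and `g : k → k` of degrees `s` and `t`, as given by the sign rule
`(f ⊗ g)(m ⊗ c) = (-1)^{|g|·|m|} f(m) ⊗ g(c)`, to a homomorphism `M → N` of degree `s + t`. -/
noncomputable def shiftTensor (M : SuperMod k p) (s t r : ZMod 2) (h : s + t = r) :
    shift r M ⟶ (tensorLeft (shift s M)).obj (shift t (triv k p)) where
  lin := (TensorProduct.mk k (shift s M).carrier (shift t (triv k p)).carrier).flip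
    (shiftOne k p t) ∘ₗ shiftParity M t r s
  map_act := map_act_of_gens (M := shift r M) (N := tensor (shift s M) (shift t (triv k p))) _
    (fun m => by
      have h1 (x : (shift s M).carrier) :
          (shift s M).act (P1.u k p) x ⊗ₜ[k] shiftOne k p t =
            tensorU (shift s M) (shift t (triv k p)) (x ⊗ₜ[k] shiftOne k p t) := by
        rw [tensorU_tmul, shift_triv_act_u, LinearMap.zero_apply, TensorProduct.tmul_zero,
          add_zero]
      rw [tensor_act_u]
      refine Eq.trans ?_ (h1 (shiftParity M t r s m))
      exact congrArg (· ⊗ₜ[k] shiftOne k p t) (shiftParity_u M t r s m))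
    (fun m => by
      have h1 (x : (shift s M).carrier) :
          (shift s M).act (P1.v k p) x ⊗ₜ[k] shiftOne k p t =
            tensorV (shift s M) (shift t (triv k p)) (x ⊗ₜ[k] shiftOne k p t) := by
        rw [tensorV_tmul, shift_triv_act_v, LinearMap.zero_apply, TensorProduct.tmul_zero,
          add_zero]
      rw [tensor_act_v]
      refine Eq.trans ?_ (h1 (shiftParity M t r s m))
      exact congrArg (· ⊗ₜ[k] shiftOne k p t) (shiftParity_v M h m))
  map_gr := by
    intro i m hm
    have h2 := tmul_mem (shiftParity_mem M h hm) (shiftOne_mem (k := k) (p := p) t)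
    rw [add_assoc, CharTwo.add_self_eq_zero, add_zero] at h2
    exact h2

end Tensor

end SuperMod

/-! ### Extension groups and cup products -/

instance (k : Type u) [Field k] (p : ℕ) : HasExt.{u + 1} (SuperMod k p) := HasExt.standard _

variable {k : Type u} [Field k] {p : ℕ}

/-- The component of degree `s` of the superspace `Ext^n(M, N) = Ext^n(M, N)_0 ⊕ Ext^n(M, N)_1`.
The homomorphisms `M → N` of degree `s` are the morphisms `shift s M ⟶ N` of the abelian category
of supermodules and even homomorphisms, so their right derived functors in `N` are the extension
groups of this category out of `shift s M`. -/
abbrev SExt (M N : SuperMod k p) (n : ℕ) (s : ZMod 2) : Type (u + 1) :=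
  Abelian.Ext (SuperMod.shift s M) N n

/-- The identity map `1_M`, as an element of `Ext^0(M, M)_0`. -/
noncomputable def SExt.one (M : SuperMod k p) : SExt M M 0 0 :=
  Abelian.Ext.mk₀ (SuperMod.shiftZero M)

variable [Fact p.Prime] [CharP k p]

/-- The component of degree `s` of the cohomology `H^n(P₁, k) = Ext^n(k, k)`. -/
abbrev H (k : Type u) [Field k] (p : ℕ) [Fact p.Prime] (n : ℕ) (s : ZMod 2) : Type (u + 1) :=
  SExt (SuperMod.triv k p) (SuperMod.triv k p) n s

/-- The right cup product `z ∪ w ∈ Ext^{i+j}(M, N)_{s+t}` of `z ∈ Ext^i(M, N)_s` and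
`w ∈ H^j(P₁, k)_t`. The cup product of extension classes of supermodules over the Hopf superalgebra
`P₁` is `z ⊗ w = (z ⊗ id_k) ∘ (id_M ⊗ w) ∈ Ext^{i+j}(M ⊗ k, N ⊗ k)`, where `id_M ⊗ w` is the class
obtained from `w` by the exact functor `M ⊗ -` and `∘` is the Yoneda composition. With `M ⊗ k = M`
and `N ⊗ k = N`, where `z ⊗ id_k = z`, it is `z ∘ (id_M ⊗ w)`. -/
noncomputable def SExt.cup {M N : SuperMod k p} {i j n : ℕ} {s t r : ZMod 2}
    (z : SExt M N i s) (w : H k p j t) (hn : i + j = n) (hr : s + t = r) : SExt M N n r :=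
  (Abelian.Ext.mk₀ (SuperMod.shiftTensor M s t r hr)).comp
    ((w.mapExactFunctor (SuperMod.tensorLeft (SuperMod.shift s M))).comp
      ((Abelian.Ext.mk₀ (SuperMod.unitor (SuperMod.shift s M))).comp z (zero_add i))
      ((add_comm j i).trans hn))
    (zero_add n)

end SuperP1

/-!
The supermodule `E = P₁/⟨u⟩ = k[v]/⟨v²⟩` is an extension of `k` by a shifted copy of `k`
(`dualComplex`), and its class spans `H¹(P₁, k)₁`: by the long exact sequence this follows from
`Ext¹(E, k) = 0` in the relevant parity (`exists_eq_smul_extClass`). For a supermodule `L`, the class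
`L ⊗ y` is therefore, up to a nonzero scalar, the class of an extension with middle term `L ⊗ E`.

Since `E` is induced from the trivial module of the sub-Hopf-algebra `k[u]`, the tensor identity
shows that `L ⊗ E` is induced from the `k[u]`-module `L` (`IsDualBasis.isInduced`). As `k[u]` has
global dimension one, with the characteristic sequence `0 → L[u] → L[u] → L → 0` as a free
resolution, inducing it gives a free resolution of length one of `L ⊗ E` (`IsInduced.shortExact`).
So `Extⁱ(L ⊗ E, N) = 0` for `i ≥ 2`, and the connecting homomorphism, which is the cup product
with `y`, is bijective on `Extⁱ` for `i ≥ 2` (`bijective_cup`).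

If `M` has finite projective dimension, iterating this bijection shows `Ext²(M, M) = 0`. If
`1_M ∪ y² = 0`, then `M ⊗ y² = 0`. But `M ⊗ y²` is the Yoneda product of two classes each of which
acts bijectively on `Extⁱ` for `i ≥ 2`, so `Extⁱ(M, N) = 0` for all `N` and `i ≥ 2`
(`ext_eq_zero_of_mapExactFunctor_cup`).
-/

namespace SuperP1

open CategoryTheory CategoryTheory.Limits
open scoped TensorProduct

universe u

namespace SuperMod

variable {k : Type u} [Field k] {p : ℕ}

/-! ### Short exact sequences of supermodules -/

lemma mono_of_injective {M N : SuperMod k p} (f : M ⟶ N) (hf : Function.Injective f.lin) :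
    Mono f :=
  ⟨fun _ _ h => hom_ext fun x => hf (LinearMap.congr_fun (congrArg Hom.lin h) x)⟩

lemma epi_of_surjective {M N : SuperMod k p} (f : M ⟶ N) (hf : Function.Surjective f.lin) :
    Epi f :=
  ⟨fun _ _ h => hom_ext fun x => by
    obtain ⟨m, rfl⟩ := hf x
    exact LinearMap.congr_fun (congrArg Hom.lin h) m⟩

lemma shortExact_of_lin {L M N : SuperMod k p} (f : L ⟶ M) (g : M ⟶ N) (w : f ≫ g = 0)
    (hf : Function.Injective f.lin) (hg : Function.Surjective g.lin)
    (he : ∀ m, g.lin m = 0 → ∃ x, f.lin x = m) : (ShortComplex.mk f g w).ShortExact :=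
  ShortComplex.ShortExact.mk'
    (ShortComplex.exact_of_f_is_kernel _ (nonempty_isLimit g f w hf he).some)
    (mono_of_injective f hf) (epi_of_surjective g hg)

lemma isIso_of_bijective {M N : SuperMod k p} (f : M ⟶ N) (hf : Function.Bijective f.lin) :
    IsIso f :=
  have := mono_of_injective f hf.1
  have := epi_of_surjective f hf.2
  isIso_of_mono_of_epi f

lemma isIso_shiftZero (M : SuperMod k p) : IsIso (shiftZero M) :=
  isIso_of_bijective _ Function.bijective_id

lemma act_v_act_v (M : SuperMod k p) (m : M.carrier) :
    M.act (P1.v k p) (M.act (P1.v k p) m) = -(M.act (P1.u k p) ^ p) m := by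
  have h : M.act (P1.u k p) ^ p + M.act (P1.v k p) ^ 2 = 0 := by
    rw [← map_pow, ← map_pow, ← map_add, P1.u_pow_add_v_sq, map_zero]
  rw [← Module.End.mul_apply, ← sq, ← LinearMap.neg_apply, eq_neg_of_add_eq_zero_right h]

/-! ### Free supermodules -/

section Coefficients

variable {V X : Type u} [AddCommGroup V] [Module k V] [AddCommGroup X] [Module k X]

variable (k V) in
/-- Multiplication by `u` on `V[u]`, a polynomial being encoded as the finitely supported function
of its coefficients. -/
noncomputable def shiftEnd : Module.End k (ℕ →₀ V) := Finsupp.lmapDomain V k Nat.succ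

@[simp] lemma shiftEnd_single (n : ℕ) (m : V) :
    shiftEnd k V (Finsupp.single n m) = Finsupp.single (n + 1) m :=
  Finsupp.mapDomain_single

lemma shiftEnd_zero (x : ℕ →₀ V) : shiftEnd k V x 0 = 0 :=
  Finsupp.mapDomain_of_notMem_range _ _ (by simp)

lemma shiftEnd_succ (x : ℕ →₀ V) (n : ℕ) : shiftEnd k V x (n + 1) = x n :=
  Finsupp.mapDomain_apply Nat.succ_injective x n

lemma shiftEnd_mem {W : Submodule k V} {x : ℕ →₀ V} (hx : ∀ n, x n ∈ W) (n : ℕ) :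
    shiftEnd k V x n ∈ W := by
  cases n with
  | zero => rw [shiftEnd_zero]; exact zero_mem _
  | succ n => rw [shiftEnd_succ]; exact hx n

lemma shiftEnd_pow_mem {W : Submodule k V} {x : ℕ →₀ V} (hx : ∀ n, x n ∈ W) (a n : ℕ) :
    (shiftEnd k V ^ a) x n ∈ W := by
  induction a generalizing n with
  | zero => exact hx n
  | succ a ih => rw [pow_succ', Module.End.mul_apply]; exact shiftEnd_mem ih n

/-- The map `V[u] → X` sending `m u^n` to `A^n (j m)`. -/
noncomputable def evalEnd (A : Module.End k X) (j : V →ₗ[k] X) : (ℕ →₀ V) →ₗ[k] X :=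
  Finsupp.lsum k fun n => (A ^ n) ∘ₗ j

@[simp] lemma evalEnd_single (A : Module.End k X) (j : V →ₗ[k] X) (n : ℕ) (m : V) :
    evalEnd A j (Finsupp.single n m) = (A ^ n) (j m) := by
  simp [evalEnd]

lemma evalEnd_shiftEnd (A : Module.End k X) (j : V →ₗ[k] X) (x : ℕ →₀ V) :
    evalEnd A j (shiftEnd k V x) = A (evalEnd A j x) := by
  induction x using Finsupp.induction_linear with
  | zero => simp
  | add x y hx hy => simp only [map_add, hx, hy]
  | single n m => simp [pow_succ']

lemma evalEnd_shiftEnd_pow (A : Module.End k X) (j : V →ₗ[k] X) (a : ℕ) (x : ℕ →₀ V) :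
    evalEnd A j ((shiftEnd k V ^ a) x) = (A ^ a) (evalEnd A j x) := by
  induction a with
  | zero => simp
  | succ a ih => rw [pow_succ', pow_succ', Module.End.mul_apply, evalEnd_shiftEnd, ih,
      Module.End.mul_apply]

lemma evalEnd_mem {W : Submodule k V} {Y : Submodule k X} {A : Module.End k X} {j : V →ₗ[k] X}
    (hA : ∀ y ∈ Y, A y ∈ Y) (hj : ∀ m ∈ W, j m ∈ Y) {x : ℕ →₀ V} (hx : ∀ n, x n ∈ W) :
    evalEnd A j x ∈ Y := by
  have hp (n : ℕ) (y : X) (hy : y ∈ Y) : (A ^ n) y ∈ Y := by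
    induction n with
    | zero => exact hy
    | succ n ih => rw [pow_succ', Module.End.mul_apply]; exact hA _ ih
  rw [evalEnd, Finsupp.lsum_apply]
  exact Submodule.sum_mem _ fun n _ => hp _ _ (hj _ (hx n))

/-- The characteristic map `u - B` on `V[u]`, for an endomorphism `B` of `V`. -/
noncomputable def charEnd (B : Module.End k V) : Module.End k (ℕ →₀ V) :=
  shiftEnd k V - Finsupp.mapRange.linearMap B

lemma charEnd_apply_succ (B : Module.End k V) (x : ℕ →₀ V) (n : ℕ) :
    charEnd B x (n + 1) = x n - B (x (n + 1)) := by
  simp [charEnd, shiftEnd_succ]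

@[simp] lemma charEnd_single (B : Module.End k V) (n : ℕ) (m : V) :
    charEnd B (Finsupp.single n m) = Finsupp.single (n + 1) m - Finsupp.single n (B m) := by
  simp [charEnd]

lemma charEnd_shiftEnd (B : Module.End k V) (x : ℕ →₀ V) :
    charEnd B (shiftEnd k V x) = shiftEnd k V (charEnd B x) := by
  induction x using Finsupp.induction_linear with
  | zero => simp
  | add x y hx hy => simp only [map_add, hx, hy]
  | single n m => simp

lemma charEnd_shiftEnd_pow (B : Module.End k V) (a : ℕ) (x : ℕ →₀ V) :
    charEnd B ((shiftEnd k V ^ a) x) = (shiftEnd k V ^ a) (charEnd B x) := by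
  induction a with
  | zero => simp
  | succ a ih => rw [pow_succ', Module.End.mul_apply, charEnd_shiftEnd, ih, Module.End.mul_apply]

lemma charEnd_mem {W : Submodule k V} {B : Module.End k V} (hB : ∀ m ∈ W, B m ∈ W) {x : ℕ →₀ V}
    (hx : ∀ n, x n ∈ W) (n : ℕ) : charEnd B x n ∈ W :=
  sub_mem (shiftEnd_mem hx n) (hB _ (hx n))

lemma charEnd_injective (B : Module.End k V) : Function.Injective (charEnd B) := by
  rw [injective_iff_map_eq_zero]
  intro x hx
  have hs (n : ℕ) (hn : x (n + 1) = 0) : x n = 0 := by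
    have h := charEnd_apply_succ B x n
    rw [hx, hn, map_zero, sub_zero] at h
    exact h.symm
  -- The coefficients vanish in high degrees, and from there on downwards.
  obtain ⟨N, hN⟩ : ∃ N, ∀ n, N ≤ n → x n = 0 := by
    refine ⟨x.support.sup id + 1, fun n hn => ?_⟩
    by_contra h
    have : n ≤ x.support.sup id := Finset.le_sup (f := id) (Finsupp.mem_support_iff.2 h)
    omega
  induction N with
  | zero => exact Finsupp.ext fun n => hN n (Nat.zero_le n)
  | succ N ih =>
    refine ih fun n hn => ?_
    rcases hn.eq_or_lt with rfl | h
    · exact hs _ (hN _ le_rfl)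
    · exact hN n h

lemma evalEnd_charEnd {A : Module.End k X} {B : Module.End k V} {j : V →ₗ[k] X}
    (hj : ∀ m, j (B m) = A (j m)) (x : ℕ →₀ V) : evalEnd A j (charEnd B x) = 0 := by
  induction x using Finsupp.induction_linear with
  | zero => simp
  | add x y hx hy => simp only [map_add, hx, hy, add_zero]
  | single n m => simp [hj, pow_succ]

/-- Modulo the image of `u - B`, a polynomial is congruent to its value at `B`. -/
lemma exists_charEnd_eq_sub (B : Module.End k V) (x : ℕ →₀ V) :
    ∃ y, charEnd B y = x - Finsupp.single 0 (evalEnd B LinearMap.id x) := by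
  induction x using Finsupp.induction_linear with
  | zero => exact ⟨0, by simp⟩
  | add x y hx hy =>
    obtain ⟨a, ha⟩ := hx
    obtain ⟨b, hb⟩ := hy
    exact ⟨a + b, by rw [map_add, ha, hb, map_add, Finsupp.single_add]; abel⟩
  | single n m =>
    induction n generalizing m with
    | zero => exact ⟨0, by simp⟩
    | succ n ih =>
      obtain ⟨y, hy⟩ := ih (B m)
      refine ⟨y + Finsupp.single n m, ?_⟩
      rw [map_add, hy, charEnd_single, evalEnd_single, evalEnd_single, pow_succ]
      simp

lemma map_evalEnd {A : Module.End k X} {B : Module.End k V} {j : V →ₗ[k] X}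
    (hj : ∀ m, j (B m) = A (j m)) (x : ℕ →₀ V) :
    j (evalEnd B LinearMap.id x) = evalEnd A j x := by
  obtain ⟨y, hy⟩ := exists_charEnd_eq_sub B x
  have h := evalEnd_charEnd hj y
  rw [hy, map_sub, sub_eq_zero] at h
  simpa using h.symm

end Coefficients

/-- The component of degree `i` of `M[u] ⊕ v M[u]`. -/
noncomputable def freeGr (M : SuperMod k p) (i : ZMod 2) :
    Submodule k ((ℕ →₀ M.carrier) × (ℕ →₀ M.carrier)) :=
  (Finsupp.submodule fun _ => M.gr i).prod (Finsupp.submodule fun _ => M.gr (i + 1))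

/-- The action of `v` on `M[u] ⊕ v M[u]`. -/
noncomputable def freeV (M : SuperMod k p) :
    Module.End k ((ℕ →₀ M.carrier) × (ℕ →₀ M.carrier)) :=
  (-(shiftEnd k M.carrier ^ p) ∘ₗ LinearMap.snd k _ _).prod (LinearMap.fst k _ _)

lemma free_comm (M : SuperMod k p) : (shiftEnd k M.carrier).prodMap (shiftEnd k M.carrier) *
    freeV M = freeV M * (shiftEnd k M.carrier).prodMap (shiftEnd k M.carrier) := by
  refine LinearMap.ext fun x => Prod.ext ?_ rfl
  change shiftEnd k M.carrier (-(shiftEnd k M.carrier ^ p) x.2) =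
    -(shiftEnd k M.carrier ^ p) (shiftEnd k M.carrier x.2)
  rw [map_neg, ← Module.End.mul_apply, ← Module.End.mul_apply, ← pow_succ, ← pow_succ']

lemma free_rel (M : SuperMod k p) :
    (shiftEnd k M.carrier).prodMap (shiftEnd k M.carrier) ^ p + freeV M ^ 2 = 0 := by
  have h (n : ℕ) : (shiftEnd k M.carrier).prodMap (shiftEnd k M.carrier) ^ n =
      (shiftEnd k M.carrier ^ n).prodMap (shiftEnd k M.carrier ^ n) := by
    induction n with
    | zero => rfl
    | succ n ih => rw [pow_succ, ih, LinearMap.prodMap_mul, pow_succ]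
  rw [h, sq]
  refine LinearMap.ext fun x => Prod.ext ?_ ?_
  · exact add_neg_cancel _
  · exact add_neg_cancel _

lemma isCompl_prod {V W : Type u} [AddCommGroup V] [Module k V] [AddCommGroup W] [Module k W]
    {A A' : Submodule k V} {B B' : Submodule k W} (hA : IsCompl A A') (hB : IsCompl B B') :
    IsCompl (A.prod B) (A'.prod B') := by
  constructor
  · rw [disjoint_iff, Submodule.prod_inf_prod, hA.inf_eq_bot, hB.inf_eq_bot, Submodule.prod_bot]
  · rw [codisjoint_iff, Submodule.prod_sup_prod, hA.sup_eq_top, hB.sup_eq_top, Submodule.prod_top]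

lemma isCompl_submodule (M : SuperMod k p) (i : ZMod 2) :
    IsCompl (Finsupp.submodule fun _ : ℕ => M.gr i)
      (Finsupp.submodule fun _ : ℕ => M.gr (i + 1)) := by
  constructor
  · rw [Submodule.disjoint_def]
    exact fun x h0 h1 => Finsupp.ext fun n =>
      (Submodule.disjoint_def.1 (M.isCompl_add_one i).disjoint) _ (h0 n) (h1 n)
  · rw [codisjoint_iff, eq_top_iff]
    rintro x -
    refine Submodule.mem_sup.2 ⟨Finsupp.mapRange.linearMap (M.proj i) x,
      fun n => by simpa using proj_mem _ _,
      Finsupp.mapRange.linearMap (M.proj (i + 1)) x,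
      fun n => by simpa using proj_mem _ _, Finsupp.ext fun n => ?_⟩
    have h2 : ∀ i : ZMod 2, i = 0 ∨ i = 1 := by decide
    rcases h2 i with rfl | rfl
    · simpa using M.proj_add_proj (x n)
    · simpa [add_comm, show (1 + 1 : ZMod 2) = 0 from rfl] using M.proj_add_proj (x n)

/-- The free supermodule on the superspace underlying a supermodule `M`. The pair `(x, y)` stands
for `x + v y`, where `x` and `y` are in `M[u]`; the given action of `P₁` on `M` plays no role. -/
noncomputable abbrev free (M : SuperMod k p) : SuperMod k p where
  carrier := (ℕ →₀ M.carrier) × (ℕ →₀ M.carrier)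
  act := P1.lift ((shiftEnd k M.carrier).prodMap (shiftEnd k M.carrier)) (freeV M)
    (free_comm M) (free_rel M)
  gr := freeGr M
  isCompl := isCompl_prod (isCompl_submodule M 0) (isCompl_submodule M 1)
  act_mem := act_mem_of_gens _ (freeGr M)
    (fun j x hx => by
      rw [P1.lift_u]
      exact ⟨shiftEnd_mem hx.1, shiftEnd_mem hx.2⟩)
    (fun j x hx => by
      rw [P1.lift_v]
      refine ⟨fun n => neg_mem (shiftEnd_pow_mem (W := M.gr (1 + j)) (fun n => ?_) p n), ?_⟩
      · rw [add_comm]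
        exact hx.2 n
      · rw [add_comm 1 j, add_assoc, CharTwo.add_self_eq_zero, add_zero]
        exact hx.1)

section Free

variable {M X : SuperMod k p}

lemma free_act_u (x y : ℕ →₀ M.carrier) :
    (free M).act (P1.u k p) (x, y) = (shiftEnd k M.carrier x, shiftEnd k M.carrier y) :=
  LinearMap.congr_fun (P1.lift_u _ (freeV M) (free_comm M) (free_rel M)) (x, y)

lemma free_act_v (x y : ℕ →₀ M.carrier) :
    (free M).act (P1.v k p) (x, y) = (-(shiftEnd k M.carrier ^ p) y, x) :=
  LinearMap.congr_fun (P1.lift_v _ (freeV M) (free_comm M) (free_rel M)) (x, y)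

/-- The homomorphism out of a free supermodule given by a linear map that preserves the grading. -/
noncomputable def freeDesc (j : M.carrier →ₗ[k] X.carrier) (hj : ∀ i, ∀ m ∈ M.gr i, j m ∈ X.gr i) :
    free M ⟶ X where
  lin := (evalEnd (X.act (P1.u k p)) j).coprod
    (X.act (P1.v k p) ∘ₗ evalEnd (X.act (P1.u k p)) j)
  map_act := map_act_of_gens (M := free M) (N := X) _
    (fun ⟨x, y⟩ => by
      rw [free_act_u]
      change evalEnd _ j (shiftEnd k _ x) + X.act _ (evalEnd _ j (shiftEnd k _ y)) =
        X.act _ (evalEnd _ j x + X.act _ (evalEnd _ j y))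
      rw [evalEnd_shiftEnd, evalEnd_shiftEnd, map_add, act_u_act_v])
    (fun ⟨x, y⟩ => by
      rw [free_act_v]
      change evalEnd _ j (-(shiftEnd k _ ^ p) y) + X.act _ (evalEnd _ j x) =
        X.act _ (evalEnd _ j x + X.act _ (evalEnd _ j y))
      rw [map_neg, evalEnd_shiftEnd_pow, map_add, act_v_act_v, add_comm])
  map_gr {i x} hx := by
    have hu (i : ZMod 2) (y : X.carrier) (hy : y ∈ X.gr i) : X.act (P1.u k p) y ∈ X.gr i := by
      simpa using X.act_mem P1.u_mem hy
    have h1 := X.act_mem P1.v_mem (evalEnd_mem (hu (i + 1)) (hj (i + 1)) hx.2)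
    rw [add_comm, add_assoc, CharTwo.add_self_eq_zero, add_zero] at h1
    exact add_mem (evalEnd_mem (hu i) (hj i) hx.1) h1

lemma freeDesc_apply (j : M.carrier →ₗ[k] X.carrier) (hj : ∀ i, ∀ m ∈ M.gr i, j m ∈ X.gr i)
    (x y : ℕ →₀ M.carrier) : (freeDesc j hj).lin (x, y) =
      evalEnd (X.act (P1.u k p)) j x + X.act (P1.v k p) (evalEnd (X.act (P1.u k p)) j y) := rfl

variable (M) in
/-- The inclusion of the generators into a free supermodule. -/
noncomputable def freeι : M.carrier →ₗ[k] (free M).carrier :=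
  LinearMap.inl k _ _ ∘ₗ Finsupp.lsingle 0

lemma freeι_mem {i : ZMod 2} {m : M.carrier} (hm : m ∈ M.gr i) : freeι M m ∈ (free M).gr i := by
  refine ⟨fun n => ?_, zero_mem _⟩
  change Finsupp.single 0 m n ∈ M.gr i
  rw [Finsupp.single_apply]
  split_ifs
  · exact hm
  · exact zero_mem _

lemma free_hom_ext {f g : free M ⟶ X} (h : ∀ m, f.lin (freeι M m) = g.lin (freeι M m)) : f = g := by
  have h1 (x : ℕ →₀ M.carrier) : f.lin (x, 0) = g.lin (x, 0) := by
    induction x using Finsupp.induction_linear with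
    | zero => exact (map_zero f.lin).trans (map_zero g.lin).symm
    | add x y hx hy =>
      have e : ((x + y, 0) : (free M).carrier) = (x, 0) + (y, 0) := Prod.ext rfl (add_zero 0).symm
      rw [e, map_add, map_add, hx, hy]
    | single n m =>
      have e : ((Finsupp.single n m, 0) : (free M).carrier) =
          (free M).act (P1.u k p ^ n) (freeι M m) := by
        induction n with
        | zero => rw [pow_zero, map_one]; rfl
        | succ n ih =>
          rw [pow_succ', map_mul, Module.End.mul_apply, ← ih, free_act_u, shiftEnd_single, map_zero]
      rw [e, f.map_act, g.map_act, h]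
  refine hom_ext fun ⟨x, y⟩ => ?_
  have e : ((x, y) : (free M).carrier) = (x, 0) + (free M).act (P1.v k p) (y, 0) := by
    rw [free_act_v, map_zero, neg_zero]
    exact Prod.ext (add_zero x).symm (zero_add y).symm
  rw [e, map_add, map_add, f.map_act, g.map_act, h1, h1]

lemma freeDesc_freeι (j : M.carrier →ₗ[k] X.carrier) (hj : ∀ i, ∀ m ∈ M.gr i, j m ∈ X.gr i)
    (m : M.carrier) : (freeDesc j hj).lin (freeι M m) = j m := by
  change (freeDesc j hj).lin (Finsupp.single 0 m, 0) = j m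
  rw [freeDesc_apply, evalEnd_single, map_zero, map_zero, add_zero, pow_zero, Module.End.one_apply]

/-- A linear map that preserves the gradings lifts along a surjective homomorphism: the
`proj_i ∘ s ∘ φ ∘ proj_i` of a linear section `s` add up to a lift that preserves the gradings. -/
lemma exists_graded_lift {A B : SuperMod k p} (e : A ⟶ B) (he : Function.Surjective e.lin)
    (φ : M.carrier →ₗ[k] B.carrier) (hφ : ∀ i, ∀ m ∈ M.gr i, φ m ∈ B.gr i) :
    ∃ ψ : M.carrier →ₗ[k] A.carrier, (∀ i, ∀ m ∈ M.gr i, ψ m ∈ A.gr i) ∧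
      ∀ m, e.lin (ψ m) = φ m := by
  obtain ⟨s, hs⟩ := e.lin.exists_rightInverse_of_surjective (LinearMap.range_eq_top.2 he)
  have hs' (b : B.carrier) : e.lin (s b) = b := LinearMap.congr_fun hs b
  let ψ : M.carrier →ₗ[k] A.carrier :=
    A.proj 0 ∘ₗ s ∘ₗ φ ∘ₗ M.proj 0 + A.proj 1 ∘ₗ s ∘ₗ φ ∘ₗ M.proj 1
  have hψ (i : ZMod 2) (m : M.carrier) (hm : m ∈ M.gr i) : ψ m = A.proj i (s (φ m)) := by
    have h2 : ∀ i : ZMod 2, i = 0 ∨ i = 1 := by decide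
    rcases h2 i with rfl | rfl <;> simp [ψ, proj_of_mem hm]
  refine ⟨ψ, fun i m hm => ?_, fun m => ?_⟩
  · rw [hψ i m hm]
    exact proj_mem _ _
  · induction m using homogeneous_induction with
    | hadd a b ha hb => simp only [map_add, ha, hb]
    | h i m hm => rw [hψ i m hm, map_proj, hs', proj_of_mem (hφ i m hm), if_pos rfl]

instance (M : SuperMod k p) : Projective (free M) where
  factors {A B} f e _ := by
    obtain ⟨ψ, hψ, h⟩ := exists_graded_lift e (surjective_of_epi e) (f.lin ∘ₗ freeι M)
      (fun i m hm => f.map_gr (freeι_mem hm))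
    refine ⟨freeDesc ψ hψ, free_hom_ext fun m => ?_⟩
    have h1 : (freeDesc ψ hψ ≫ e).lin (freeι M m) = e.lin ((freeDesc ψ hψ).lin (freeι M m)) := rfl
    rw [h1, freeDesc_freeι, h]
    rfl

/-- An even homomorphism `free M ⟶ X` vanishes if `M` and `X` are concentrated in different
degrees. -/
lemma free_hom_eq_zero (f : free M ⟶ X) (h : ∀ i, M.gr i = ⊥ ∨ X.gr i = ⊥) : f = 0 := by
  refine free_hom_ext fun m => ?_
  change f.lin (freeι M m) = 0
  induction m using homogeneous_induction with
  | hadd a b ha hb => rw [map_add, map_add, ha, hb, add_zero]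
  | h i m hm =>
    rcases h i with h | h
    · rw [h, Submodule.mem_bot] at hm
      rw [hm, map_zero, map_zero]
    · simpa [h] using f.map_gr (freeι_mem hm)

variable (M) in
/-- The homomorphism `u ⊗ 1 - 1 ⊗ u` of `free M = P₁ ⊗ M`. -/
noncomputable def charHom : free M ⟶ free M where
  lin := (charEnd (M.act (P1.u k p))).prodMap (charEnd (M.act (P1.u k p)))
  map_act := map_act_of_gens (M := free M) (N := free M) _
    (fun ⟨x, y⟩ => by
      rw [free_act_u]
      refine Eq.trans ?_ (free_act_u _ _).symm
      exact Prod.ext (charEnd_shiftEnd _ x) (charEnd_shiftEnd _ y))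
    (fun ⟨x, y⟩ => by
      rw [free_act_v]
      refine Eq.trans ?_ (free_act_v _ _).symm
      exact Prod.ext ((map_neg _ _).trans (congrArg Neg.neg (charEnd_shiftEnd_pow _ p y))) rfl)
  map_gr {i x} hx := by
    have hu (i : ZMod 2) (y : M.carrier) (hy : y ∈ M.gr i) : M.act (P1.u k p) y ∈ M.gr i := by
      simpa using M.act_mem P1.u_mem hy
    exact ⟨charEnd_mem (hu i) hx.1, charEnd_mem (hu (i + 1)) hx.2⟩

end Free

/-! ### Supermodules induced from `k[u]` -/

/-- The supermodule `X` is induced, as a supermodule over `P₁`, from the graded `k[u]`-module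
underlying `M`, along `j`: the map `j` respects `u` and the gradings, and `X = j(M) ⊕ v j(M)`. -/
structure IsInduced {M X : SuperMod k p} (j : M.carrier →ₗ[k] X.carrier) : Prop where
  map_u : ∀ m, j (M.act (P1.u k p) m) = X.act (P1.u k p) (j m)
  map_gr : ∀ i, ∀ m ∈ M.gr i, j m ∈ X.gr i
  bijective : Function.Bijective fun x : M.carrier × M.carrier => j x.1 + X.act (P1.v k p) (j x.2)

namespace IsInduced

variable {M X : SuperMod k p} {j : M.carrier →ₗ[k] X.carrier} (hj : IsInduced j)
include hj

lemma charHom_comp_freeDesc : charHom M ≫ freeDesc j hj.map_gr = 0 :=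
  hom_ext fun ⟨x, y⟩ => by
    change evalEnd _ j (charEnd _ x) + X.act _ (evalEnd _ j (charEnd _ y)) = 0
    rw [evalEnd_charEnd hj.map_u, evalEnd_charEnd hj.map_u, map_zero, add_zero]

/-- The free resolution `0 → P₁ ⊗ M → P₁ ⊗ M → X → 0` of an induced supermodule. -/
lemma shortExact : (ShortComplex.mk _ _ hj.charHom_comp_freeDesc).ShortExact := by
  have h1 (z : (free M).carrier) : (freeDesc j hj.map_gr).lin z =
      j (evalEnd (M.act (P1.u k p)) LinearMap.id z.1) +
        X.act (P1.v k p) (j (evalEnd (M.act (P1.u k p)) LinearMap.id z.2)) := by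
    rw [map_evalEnd hj.map_u, map_evalEnd hj.map_u]
    rfl
  refine shortExact_of_lin _ _ _ ?_ ?_ ?_
  · exact (charEnd_injective _).prodMap (charEnd_injective _)
  · intro x
    obtain ⟨⟨a, b⟩, rfl⟩ := hj.bijective.2 x
    exact ⟨(Finsupp.single 0 a, Finsupp.single 0 b), by rw [h1]; simp⟩
  · intro z hz
    rw [h1] at hz
    have h2 := hj.bijective.1 (a₁ := (evalEnd (M.act (P1.u k p)) LinearMap.id z.1,
      evalEnd (M.act (P1.u k p)) LinearMap.id z.2)) (a₂ := 0) (by simpa using hz)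
    obtain ⟨h3, h4⟩ := Prod.mk_eq_zero.1 h2
    obtain ⟨a, ha⟩ := exists_charEnd_eq_sub (M.act (P1.u k p)) z.1
    obtain ⟨b, hb⟩ := exists_charEnd_eq_sub (M.act (P1.u k p)) z.2
    rw [h3, Finsupp.single_zero, sub_zero] at ha
    rw [h4, Finsupp.single_zero, sub_zero] at hb
    exact ⟨(a, b), Prod.ext ha hb⟩

end IsInduced

/-- The supermodule `E` has the `k`-basis `e`, `v • e`, with `e` of degree `t` and `u • e = 0`. -/
structure IsDualBasis (E : SuperMod k p) (t : ZMod 2) (e : E.carrier) : Prop where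
  mem : e ∈ E.gr t
  act_u : E.act (P1.u k p) e = 0
  bijective : Function.Bijective fun c : k × k => c.1 • e + c.2 • E.act (P1.v k p) e

/-! ### The supermodule `P₁ / ⟨u⟩` -/

section Dual

variable [Fact p.Prime]

variable (k) in
/-- The component of degree `i` of `k e ⊕ k (v e)`, where `e` is odd. -/
def dualGr (i : ZMod 2) : Submodule k (k × k) :=
  Submodule.prod (if i + 1 = 0 then ⊤ else ⊥) (if i = 0 then ⊤ else ⊥)

variable (k) in
/-- The action of `v` on `k e ⊕ k (v e)`. -/
def dualV : Module.End k (k × k) := LinearMap.inr k k k ∘ₗ LinearMap.fst k k k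

variable (k p) in
lemma dual_rel : (0 : Module.End k (k × k)) ^ p + dualV k ^ 2 = 0 := by
  rw [zero_pow (Fact.out : p.Prime).ne_zero, zero_add, sq]
  exact LinearMap.ext fun x => rfl

variable (k p) in
/-- The supermodule `P₁ / ⟨u⟩` with its parity shifted. The pair `(a, b)` stands for
`a e + b (v e)`, where `e` is the odd generator. -/
noncomputable abbrev dual : SuperMod k p where
  carrier := k × k
  act := P1.lift 0 (dualV k) (by simp) (dual_rel k p)
  gr := dualGr k
  isCompl := by
    constructor
    · rw [disjoint_iff, dualGr, dualGr, Submodule.prod_inf_prod]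
      simp
    · rw [codisjoint_iff, dualGr, dualGr, Submodule.prod_sup_prod]
      simp [show (1 + 1 : ZMod 2) = 0 from rfl]
  act_mem := act_mem_of_gens _ (dualGr k)
    (fun j x _ => by
      rw [P1.lift_u]
      exact zero_mem _)
    (fun j x hx => by
      rw [P1.lift_v]
      refine ⟨zero_mem _, ?_⟩
      rw [add_comm]
      exact hx.1)

lemma dual_act_u (x : (dual k p).carrier) : (dual k p).act (P1.u k p) x = 0 :=
  LinearMap.congr_fun (P1.lift_u 0 (dualV k) (by simp) (dual_rel k p)) x

lemma dual_act_v (x : (dual k p).carrier) :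
    (dual k p).act (P1.v k p) x = ((0, x.1) : k × k) :=
  LinearMap.congr_fun (P1.lift_v 0 (dualV k) (by simp) (dual_rel k p)) x

lemma isDualBasis_dual : IsDualBasis (dual k p) 1 ((1, 0) : k × k) where
  mem := ⟨trivial, zero_mem _⟩
  act_u := dual_act_u _
  bijective := by
    rw [dual_act_v]
    convert Function.bijective_id (α := k × k) using 1
    refine funext fun c => Prod.ext ?_ ?_
    · change c.1 * 1 + c.2 * 0 = c.1
      simp
    · change c.1 * 0 + c.2 * 1 = c.2
      simp

lemma isInduced_dual : IsInduced (M := shift 1 (triv k p)) (X := dual k p)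
    (LinearMap.inl k k k) where
  map_u m := by
    rw [shift_triv_act_u, dual_act_u]
    exact map_zero (LinearMap.inl k k k)
  map_gr i m hm := ⟨hm, zero_mem _⟩
  bijective := by
    have h (c : k × k) : LinearMap.inl k k k c.1 +
        (dual k p).act (P1.v k p) (LinearMap.inl k k k c.2) = c := by
      rw [dual_act_v]
      exact Prod.ext (add_zero _) (zero_add _)
    exact Eq.mpr (congrArg Function.Bijective (funext h)) Function.bijective_id

variable (k p) in
/-- The inclusion of the socle into `dual k p`. -/
noncomputable def dualι : triv k p ⟶ dual k p where
  lin := LinearMap.inr k k k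
  map_act := map_act_of_gens (M := triv k p) (N := dual k p) (LinearMap.inr k k k)
    (fun m => by rw [triv_act_u, dual_act_u]; rfl)
    (fun m => by rw [triv_act_v, dual_act_v]; rfl)
  map_gr hm := ⟨zero_mem _, hm⟩

variable (k p) in
/-- The projection of `dual k p` to its top. -/
noncomputable def dualπ : dual k p ⟶ shift 1 (triv k p) where
  lin := LinearMap.fst k k k
  map_act := map_act_of_gens (M := dual k p) (N := shift 1 (triv k p)) (LinearMap.fst k k k)
    (fun m => by rw [shift_triv_act_u, dual_act_u]; rfl)
    (fun m => by rw [shift_triv_act_v, dual_act_v]; rfl)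
  map_gr hm := hm.1

variable (k p) in
/-- The extension `0 → k → P₁/⟨u⟩ → k → 0`, with the parities such that it represents a class in
`H¹(P₁, k)₁`. -/
noncomputable abbrev dualComplex : ShortComplex (SuperMod k p) :=
  ShortComplex.mk (dualι k p) (dualπ k p) (hom_ext fun _ => rfl)

variable (k p) in
lemma dualComplex_shortExact : (dualComplex k p).ShortExact :=
  shortExact_of_lin _ _ _ (LinearMap.inr_injective (R := k) (M := k) (M₂ := k))
    (LinearMap.fst_surjective (R := k) (M := k) (M₂ := k)) fun m hm => ⟨m.2, Prod.ext (Eq.symm hm) rfl⟩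

end Dual

/-! ### Tensor products with `P₁ / ⟨u⟩` -/

section Tensor

variable [Fact p.Prime] [CharP k p]

/-- The tensor identity: `L ⊗ E` is induced from `k[u]`, as `E` is. -/
lemma IsDualBasis.isInduced {E : SuperMod k p} {t : ZMod 2} {e : E.carrier}
    (he : IsDualBasis E t e) (L : SuperMod k p) :
    IsInduced (M := shift t L) (X := tensor L E)
      ((TensorProduct.mk k L.carrier E.carrier).flip e) where
  map_u m := by
    have h (m : L.carrier) : L.act (P1.twist t (P1.u k p)) m ⊗ₜ[k] e = tensorU L E (m ⊗ₜ[k] e) := by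
      rw [P1.twist_u, tensorU_tmul, he.act_u, TensorProduct.tmul_zero, add_zero]
    rw [tensor_act_u]
    exact h m
  map_gr i m hm := by
    have h (m : L.carrier) (hm : m ∈ L.gr (i + t)) : m ⊗ₜ[k] e ∈ tensorGr L E i := by
      have h1 := tmul_mem hm he.mem
      rwa [add_assoc, CharTwo.add_self_eq_zero, add_zero] at h1
    exact h m hm
  bijective := by
    let φ : (k × k) ≃ₗ[k] E.carrier := LinearEquiv.ofBijective
      ((LinearMap.toSpanSingleton k E.carrier e).coprod
        (LinearMap.toSpanSingleton k E.carrier (E.act (P1.v k p) e))) he.bijective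
    let Φ : (L.carrier × L.carrier) ≃ₗ[k] L.carrier ⊗[k] E.carrier :=
      ((TensorProduct.rid k L.carrier).symm.prodCongr (TensorProduct.rid k L.carrier).symm).trans
        ((TensorProduct.prodRight k k L.carrier k k).symm.trans (φ.lTensor L.carrier))
    have hΦ (x y : L.carrier) : Φ (x, y) = x ⊗ₜ e + y ⊗ₜ E.act (P1.v k p) e := by
      have h1 : (x ⊗ₜ[k] (1 : k), y ⊗ₜ[k] (1 : k)) = TensorProduct.prodRight k k L.carrier k k
          (x ⊗ₜ (1, 0) + y ⊗ₜ (0, 1)) := by simp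
      have h2 : Φ (x, y) = φ.lTensor L.carrier ((TensorProduct.prodRight k k L.carrier k k).symm
        (x ⊗ₜ[k] (1 : k), y ⊗ₜ[k] (1 : k))) := rfl
      have h3 : φ (1, 0) = e := by
        change (1 : k) • e + (0 : k) • E.act (P1.v k p) e = e
        simp
      have h4 : φ (0, 1) = E.act (P1.v k p) e := by
        change (0 : k) • e + (1 : k) • E.act (P1.v k p) e = E.act (P1.v k p) e
        simp
      rw [h2, h1, LinearEquiv.symm_apply_apply, map_add, LinearEquiv.lTensor_tmul,
        LinearEquiv.lTensor_tmul, h3, h4]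
    -- In terms of the decomposition `L ⊗ E = L ⊗ e ⊕ L ⊗ v e`, the map is triangular.
    have hs : Function.Bijective fun x : L.carrier × L.carrier =>
        (x.1 + L.act (P1.v k p) x.2, L.parity 1 x.2) := by
      refine Function.bijective_iff_has_inverse.2
        ⟨fun x => (x.1 - L.act (P1.v k p) (L.parity 1 x.2), L.parity 1 x.2), fun x => ?_,
          fun x => ?_⟩
      · simp [parity_parity]
      · simp [parity_parity]
    have h (x : L.carrier × L.carrier) : x.1 ⊗ₜ[k] e + tensorV L E (x.2 ⊗ₜ[k] e) =
        Φ (x.1 + L.act (P1.v k p) x.2, L.parity 1 x.2) := by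
      rw [hΦ, tensorV_tmul, TensorProduct.add_tmul, add_assoc]
    rw [tensor_act_v]
    refine Eq.mp (congrArg Function.Bijective (funext fun x => ?_)) (Φ.bijective.comp hs)
    exact (h x).symm

/-- Tensoring with a shifted trivial supermodule only moves the degree of the basis. -/
lemma IsDualBasis.shift_triv_tensor {E : SuperMod k p} {t : ZMod 2} {e : E.carrier}
    (he : IsDualBasis E t e) (s : ZMod 2) :
    IsDualBasis (tensor (shift s (triv k p)) E) (s + t) (shiftOne k p s ⊗ₜ[k] e) where
  mem := tmul_mem (shiftOne_mem s) he.mem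
  act_u := by
    rw [tensor_act_u]
    refine (tensorU_tmul _ _).trans ?_
    rw [shift_triv_act_u, he.act_u, LinearMap.zero_apply, TensorProduct.zero_tmul,
      TensorProduct.tmul_zero]
    exact add_zero _
  bijective := by
    have h (c : k) : (TensorProduct.mk k (shift s (triv k p)).carrier E.carrier).flip e c =
        c • (shiftOne k p s ⊗ₜ[k] e) := by
      have h1 : c • shiftOne k p s = c := mul_one c
      exact (congrArg (· ⊗ₜ[k] e) h1.symm).trans (TensorProduct.smul_tmul' c _ e).symm
    refine Eq.mp (congrArg Function.Bijective (funext fun c => ?_))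
      (he.isInduced (shift s (triv k p))).bijective
    refine congrArg₂ (· + ·) (h c.1) ?_
    exact (congrArg _ (h c.2)).trans (map_smul _ _ _)

lemma isIso_unitor (M : SuperMod k p) : IsIso (unitor M) :=
  isIso_of_bijective _ (TensorProduct.rid k M.carrier).bijective

lemma isIso_shiftTensor (M : SuperMod k p) (s t r : ZMod 2) (h : s + t = r) :
    IsIso (shiftTensor M s t r h) := by
  have h1 : Function.Bijective (M.parity t) :=
    Function.bijective_iff_has_inverse.2 ⟨M.parity t, parity_parity t, parity_parity t⟩
  exact isIso_of_bijective _ ((TensorProduct.rid k M.carrier).symm.bijective.comp h1)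

end Tensor

end SuperMod

/-! ### Composition with extension classes -/

section Ext

universe w v u'

variable {C : Type u'} [Category.{v} C] [Abelian C] [HasExt.{w} C]

lemma bijective_mk₀_comp {X X' : C} (f : X ⟶ X') [IsIso f] (Y : C) (i : ℕ) :
    Function.Bijective fun z : Abelian.Ext X' Y i => (Abelian.Ext.mk₀ f).comp z (zero_add i) :=
  Function.bijective_iff_has_inverse.2
    ⟨fun z => (Abelian.Ext.mk₀ (inv f)).comp z (zero_add i), fun z => by simp, fun z => by simp⟩

lemma eq_zero_of_comp_mk₀ {X Y Y' : C} (f : Y ⟶ Y') [IsIso f] {i : ℕ} {z : Abelian.Ext X Y i}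
    (h : z.comp (Abelian.Ext.mk₀ f) (add_zero i) = 0) : z = 0 := by
  have h1 : (z.comp (Abelian.Ext.mk₀ f) (add_zero i)).comp (Abelian.Ext.mk₀ (inv f))
      (add_zero i) = z := by simp
  rw [← h1, h, Abelian.Ext.zero_comp]

/-- Dimension shifting along a short exact sequence whose middle term has finite projective
dimension. -/
lemma bijective_extClass_comp {S : ShortComplex C} (hS : S.ShortExact) {n i : ℕ}
    [HasProjectiveDimensionLT S.X₂ n] (hi : n ≤ i) (Y : C) :
    Function.Bijective fun z : Abelian.Ext S.X₁ Y i => hS.extClass.comp z (add_comm 1 i) := by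
  have h1 := HasProjectiveDimensionLT.subsingleton S.X₂ n i hi Y
  have h2 := HasProjectiveDimensionLT.subsingleton S.X₂ n (i + 1) (hi.trans i.le_succ) Y
  constructor
  · refine (injective_iff_map_eq_zero (hS.extClass.precomp Y (add_comm 1 i))).2 fun z hz => ?_
    obtain ⟨x, rfl⟩ := Abelian.Ext.contravariant_sequence_exact₁ hS Y z (add_comm 1 i) hz
    rw [Subsingleton.elim x 0, Abelian.Ext.comp_zero]
  · intro z
    exact Abelian.Ext.contravariant_sequence_exact₃ hS Y z (Subsingleton.elim _ _) (add_comm 1 i)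

lemma bijective_smul_extClass_comp {k : Type*} [Field k] [Linear k C] {c : k} (hc : c ≠ 0)
    {S : ShortComplex C} (hS : S.ShortExact) {n i : ℕ} [HasProjectiveDimensionLT S.X₂ n]
    (hi : n ≤ i) (Y : C) :
    Function.Bijective
      fun z : Abelian.Ext S.X₁ Y i => (c • hS.extClass).comp z (add_comm 1 i) := by
  simp only [Abelian.Ext.smul_comp]
  exact (MulAction.bijective₀ hc).comp (bijective_extClass_comp hS hi Y)

end Ext

variable {k : Type u} [Field k] {p : ℕ}

/-! ### Extensions of induced supermodules -/

namespace SuperMod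

variable {M X : SuperMod k p} {j : M.carrier →ₗ[k] X.carrier}

lemma IsInduced.hasProjectiveDimensionLT (hj : IsInduced j) : HasProjectiveDimensionLT X 2 :=
  hj.shortExact.hasProjectiveDimensionLT_X₃ 1 inferInstance
    (hasProjectiveDimensionLT_of_ge (free M) 1 2 (by decide))

lemma IsInduced.ext_one_eq_zero (hj : IsInduced j) {Y : SuperMod k p}
    (h : ∀ f : free M ⟶ Y, f = 0) (x : Abelian.Ext X Y 1) : x = 0 := by
  have h1 := HasProjectiveDimensionLT.subsingleton (free M) 1 1 le_rfl Y
  obtain ⟨z, rfl⟩ := Abelian.Ext.contravariant_sequence_exact₃ hj.shortExact Y x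
    (Subsingleton.elim _ _) (add_zero 1)
  obtain ⟨f, rfl⟩ := (Abelian.Ext.mk₀_bijective _ _).2 z
  rw [h f, Abelian.Ext.mk₀_zero, Abelian.Ext.comp_zero]

end SuperMod

open SuperMod

/-! ### Cup product with a class of odd degree in `H¹` -/

section Cup

variable [Fact p.Prime]

lemma triv_hom_eq_smul_id (f : triv k p ⟶ triv k p) : ∃ c : k, f = c • 𝟙 _ := by
  let g : k →ₗ[k] k := f.lin
  refine ⟨g 1, hom_ext fun m => ?_⟩
  have h (m : k) : g m = g 1 * m := by
    rw [← smul_eq_mul, ← mul_one m, ← smul_eq_mul m 1, map_smul, smul_eq_mul, smul_eq_mul]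
    ring
  exact h m

/-- The space `H¹(P₁, k)₁` is spanned by the class of `0 → k → P₁/⟨u⟩ → k → 0`. -/
lemma exists_eq_smul_extClass (y : H k p 1 1) :
    ∃ c : k, y = c • (dualComplex_shortExact k p).extClass := by
  -- Shifted by one, `k` lives in odd degree, so the even homomorphisms to `k` vanish.
  have h0 (f : free (shift 1 (triv k p)) ⟶ triv k p) : f = 0 := by
    refine free_hom_eq_zero f fun i => ?_
    have h2 : ∀ i : ZMod 2, i = 0 ∨ i = 1 := by decide
    rcases h2 i with rfl | rfl
    · exact Or.inl rfl
    · exact Or.inr rfl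
  obtain ⟨x, hx⟩ := Abelian.Ext.contravariant_sequence_exact₃ (dualComplex_shortExact k p)
    (triv k p) y (isInduced_dual.ext_one_eq_zero h0 _) (add_zero 1)
  obtain ⟨f, rfl⟩ := (Abelian.Ext.mk₀_bijective _ _).2 x
  obtain ⟨c, rfl⟩ := triv_hom_eq_smul_id f
  refine ⟨c, ?_⟩
  rw [← hx]
  exact (Abelian.Ext.smul_eq_comp_mk₀ _ _).symm

variable [CharP k p]

lemma mapExactFunctor_smul_extClass (L : SuperMod k p) (c : k) {S : ShortComplex (SuperMod k p)}
    (hS : S.ShortExact) : (c • hS.extClass).mapExactFunctor (tensorLeft L) =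
      c • (hS.map_of_exact (tensorLeft L)).extClass := by
  rw [Functor.mapExactFunctor_smul, Abelian.Ext.mapExactFunctor_extClass]
  rfl

variable {y : H k p 1 1} (hy : y ≠ 0)
include hy

/-- Up to a scalar, `L ⊗ y` is the class of `0 → L → L ⊗ P₁/⟨u⟩ → L → 0`, with the quotient
`L` shifted, whose middle term is induced from `k[u]`. -/
lemma bijective_tensor_comp (L N : SuperMod k p) {i : ℕ} (hi : 2 ≤ i) :
    Function.Bijective fun z : Abelian.Ext ((tensorLeft L).obj (triv k p)) N i =>
      (y.mapExactFunctor (tensorLeft L)).comp z (add_comm 1 i) := by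
  obtain ⟨c, rfl⟩ := exists_eq_smul_extClass y
  have hc : c ≠ 0 := by
    rintro rfl
    exact hy (zero_smul _ _)
  have h : HasProjectiveDimensionLT ((dualComplex k p).map (tensorLeft L)).X₂ 2 :=
    (isDualBasis_dual.isInduced L).hasProjectiveDimensionLT
  have hS := (dualComplex_shortExact k p).map_of_exact (tensorLeft L)
  have h1 : Abelian.Ext.mapExactFunctor (tensorLeft L)
      (c • (dualComplex_shortExact k p).extClass) = c • hS.extClass :=
    mapExactFunctor_smul_extClass L c _
  have h2 := bijective_smul_extClass_comp hc hS hi N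
  rw [← h1] at h2
  exact h2

/-- The analogue of `bijective_tensor_comp` for the class `L ⊗ (k ⊗ y)`, with a possibly shifted `k`.
It makes associativity of the cup product unnecessary. -/
lemma bijective_tensor_tensor_comp (L N : SuperMod k p) (s : ZMod 2) {i : ℕ} (hi : 2 ≤ i) :
    Function.Bijective fun z : Abelian.Ext
      ((tensorLeft L).obj ((tensorLeft (shift s (triv k p))).obj (triv k p))) N i =>
      ((y.mapExactFunctor (tensorLeft (shift s (triv k p)))).mapExactFunctor
        (tensorLeft L)).comp z (add_comm 1 i) := by
  obtain ⟨c, rfl⟩ := exists_eq_smul_extClass y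
  have hc : c ≠ 0 := by
    rintro rfl
    exact hy (zero_smul _ _)
  have h : HasProjectiveDimensionLT
      (((dualComplex k p).map (tensorLeft (shift s (triv k p)))).map (tensorLeft L)).X₂ 2 :=
    ((isDualBasis_dual.shift_triv_tensor s).isInduced L).hasProjectiveDimensionLT
  have hS := (dualComplex_shortExact k p).map_of_exact (tensorLeft (shift s (triv k p)))
  have hS' := hS.map_of_exact (tensorLeft L)
  have h1 : Abelian.Ext.mapExactFunctor (tensorLeft (shift s (triv k p)))
      (c • (dualComplex_shortExact k p).extClass) = c • hS.extClass :=
    mapExactFunctor_smul_extClass _ c _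
  have h2 : Abelian.Ext.mapExactFunctor (tensorLeft L) (c • hS.extClass) = c • hS'.extClass :=
    mapExactFunctor_smul_extClass L c _
  have h3 := bijective_smul_extClass_comp hc hS' hi N
  rw [← h2, ← h1] at h3
  exact h3

lemma bijective_cup (M N : SuperMod k p) {i : ℕ} (hi : 2 ≤ i) (s : ZMod 2) :
    Function.Bijective fun z : SExt M N i s => (z.cup y rfl rfl : SExt M N (i + 1) (s + 1)) := by
  have := isIso_unitor (shift s M)
  have := isIso_shiftTensor M s 1 (s + 1) rfl
  exact (bijective_mk₀_comp (shiftTensor M s 1 (s + 1) rfl) N (i + 1)).comp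
    ((bijective_tensor_comp hy (shift s M) N hi).comp
      (bijective_mk₀_comp (unitor (shift s M)) N i))

/-- If `y²` becomes zero after tensoring with `L`, then precomposition with the class `L ⊗ y²` is
both zero and bijective on `Ext^i(L ⊗ k, -)`, so these groups vanish. -/
lemma ext_eq_zero_of_mapExactFunctor_cup (L N : SuperMod k p)
    (h : (y.cup y rfl rfl : H k p 2 0).mapExactFunctor (tensorLeft L) = 0) {i : ℕ} (hi : 2 ≤ i)
    (z : Abelian.Ext ((tensorLeft L).obj (triv k p)) N i) : z = 0 := by
  have := isIso_unitor (shift 1 (triv k p))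
  have := isIso_shiftTensor (triv k p) 1 1 0 rfl
  have hb := (bijective_mk₀_comp ((tensorLeft L).map (shiftTensor (triv k p) 1 1 0 rfl)) N
    (i + 1 + 1)).comp ((bijective_tensor_tensor_comp hy L N 1 (hi.trans i.le_succ)).comp
      ((bijective_mk₀_comp ((tensorLeft L).map (unitor (shift 1 (triv k p)))) N (i + 1)).comp
        (bijective_tensor_comp hy L N hi)))
  have hs : ∀ z : Abelian.Ext ((tensorLeft L).obj (triv k p)) N i,
      (Abelian.Ext.mk₀ ((tensorLeft L).map (shiftTensor (triv k p) 1 1 0 rfl))).comp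
        (((y.mapExactFunctor (tensorLeft (shift 1 (triv k p)))).mapExactFunctor
          (tensorLeft L)).comp
        ((Abelian.Ext.mk₀ ((tensorLeft L).map (unitor (shift 1 (triv k p))))).comp
          ((y.mapExactFunctor (tensorLeft L)).comp z (add_comm 1 i)) (zero_add (i + 1)))
          (add_comm 1 (i + 1))) (zero_add (i + 1 + 1)) = 0 := by
    intro z
    have h1 := congrArg (fun x => Abelian.Ext.comp x z (show 2 + i = i + 1 + 1 by omega)) h
    simp only [SExt.cup, Abelian.Ext.mapExactFunctor_comp, Abelian.Ext.mapExactFunctor_mk₀,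
      Abelian.Ext.zero_comp] at h1
    rw [← h1, Abelian.Ext.comp_assoc (a₂₃ := i + 1 + 1) (h₂₃ := by omega),
      Abelian.Ext.comp_assoc (a₂₃ := i + 1) (h₂₃ := by omega),
      Abelian.Ext.comp_assoc (a₂₃ := i + 1) (h₂₃ := by omega)]
    all_goals omega
  exact hb.1 ((hs z).trans (hs 0).symm)

/-- As `1_M ∪ y²` is `M ⊗ y²` composed with isomorphisms, its vanishing means `M ⊗ y² = 0`. -/
lemma hasProjectiveDimensionLT_two_of_cup_eq_zero (M : SuperMod k p)
    (h : (SExt.one M).cup (y.cup y rfl rfl : H k p 2 0) (n := 2) (r := 0) rfl rfl = 0) :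
    HasProjectiveDimensionLT M 2 := by
  have := isIso_unitor (shift 0 M)
  have := isIso_shiftTensor M 0 0 0 rfl
  have := isIso_shiftZero M
  have h1 := (bijective_mk₀_comp (shiftTensor M 0 0 0 rfl) M 2).1
    (h.trans (Abelian.Ext.comp_zero ..).symm)
  rw [SExt.one, Abelian.Ext.mk₀_comp_mk₀] at h1
  have h2 := eq_zero_of_comp_mk₀ _ h1
  have h3 : HasProjectiveDimensionLT ((tensorLeft (shift 0 M)).obj (triv k p)) 2 :=
    .mk fun i hi Y z => ext_eq_zero_of_mapExactFunctor_cup hy _ Y h2 hi z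
  exact hasProjectiveDimensionLT_of_iso (asIso (unitor (shift 0 M) ≫ shiftZero M)) 2

/-- If `Ext^{i+2n}(M, N)₀` vanishes, so does `Ext^i(M, N)₀`, as cup product with `y` is injective. -/
lemma subsingleton_of_subsingleton_add (M N : SuperMod k p) {i : ℕ} (hi : 2 ≤ i) (n : ℕ)
    (h : Subsingleton (SExt M N (i + 2 * n) 0)) : Subsingleton (SExt M N i 0) := by
  induction n with
  | zero => exact h
  | succ n ih =>
    refine ih ?_
    have h1 : Function.Injective fun z : SExt M N (i + 2 * n) 0 =>
        ((z.cup y rfl rfl : SExt M N (i + 2 * n + 1) (0 + 1)).cup y rfl rfl :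
          SExt M N (i + 2 * n + 1 + 1) (0 + 1 + 1)) :=
      (bijective_cup hy M N (by omega) (0 + 1)).1.comp (bijective_cup hy M N (by omega) 0).1
    have h2 : Subsingleton (SExt M N (i + 2 * n + 1 + 1) (0 + 1 + 1)) := h
    exact h1.subsingleton

lemma ext_two_eq_zero_of_hasProjectiveDimensionLT (M N : SuperMod k p) (n : ℕ)
    [HasProjectiveDimensionLT M n] (z : SExt M N 2 0) : z = 0 := by
  have := isIso_shiftZero M
  have h1 : HasProjectiveDimensionLT (shift 0 M) n :=
    hasProjectiveDimensionLT_of_iso (asIso (shiftZero M)).symm n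
  have h2 := subsingleton_of_subsingleton_add hy M N le_rfl n
    (HasProjectiveDimensionLT.subsingleton (shift 0 M) n _ (by omega) N)
  exact Subsingleton.elim _ _

end Cup

end SuperP1

theorem proposition3p5 {k : Type*} [Field k] (p : ℕ) [Fact p.Prime] [CharP k p] (hp : 3 ≤ p)
    (M N : SuperP1.SuperMod k p) (y : SuperP1.H k p 1 1) (hy : y ≠ 0) :
    (∀ i : ℕ, 2 ≤ i → ∀ s : ZMod 2,
      ∃ e : SuperP1.SExt M N i s ≃ₗ[k] SuperP1.SExt M N (i + 1) (s + 1),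
        ∀ z : SuperP1.SExt M N i s, e z = z.cup y rfl rfl) ∧
    (CategoryTheory.projectiveDimension M = ⊤ ↔
      (SuperP1.SExt.one M).cup (y.cup y (n := 2) (r := 0) rfl rfl) (n := 2) (r := 0) rfl rfl ≠ 0) := by
  constructor
  · intro i hi s
    let f : SuperP1.SExt M N i s →ₗ[k] SuperP1.SExt M N (i + 1) (s + 1) :=
      { toFun := fun z => z.cup y rfl rfl
        map_add' := fun z w => by simp only [SuperP1.SExt.cup, CategoryTheory.Abelian.Ext.comp_add]
        map_smul' := fun c z => by
          simp only [SuperP1.SExt.cup, CategoryTheory.Abelian.Ext.comp_smul, RingHom.id_apply] }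
    exact ⟨LinearEquiv.ofBijective f (SuperP1.bijective_cup hy M N hi s), fun _ => rfl⟩
  · rw [← not_iff_not, not_not, ← ne_eq, CategoryTheory.projectiveDimension_ne_top_iff]
    constructor
    · rintro ⟨n, hn⟩
      exact SuperP1.ext_two_eq_zero_of_hasProjectiveDimensionLT hy M M (n + 1) _
    · intro h
      exact ⟨1, SuperP1.hasProjectiveDimensionLT_two_of_cup_eq_zero hy M h⟩
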